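/- Let $\Omega\subset\mathbb{R}^2$ be a convex set that can roll unimpeded inside a disc $\Delta$ of positive radius; that is, for every point $x$ of the boundary $\partial\Delta$ there is a translated copy of $\Omega$ that is contained in $\Delta$ and touches $\partial\Delta$ at $x$. For $R>0$ and $x\in\mathbb{R}^2$ let $$\mathcal{D}(R\Omega-x)=\#\bigl(\mathbb{Z}^2\cap(R\Omega-x)\bigr)-R^2|\Omega|,$$ where $|\Omega|$ is the area of $\Omega$; this is a $\mathbb{Z}^2$-periodic function of $x$, hence a function on the torus $\mathbb{T}^2=\mathbb{R}^2/\mathbb{Z}^2$. Then there is a constant $C$, independent of $R$, such that for every $R>2$ the function $x\mapsto\mathcal{D}(R\Omega-x)$ is in $L^4(\mathbb{T}^2)$ and $$\left\{\int_{\mathbb{T}^2}\left|\mathcal{D}(R\Omega-x)\right|^4\,dx\right\}^{1/4}\leqslant C\,R^{1/2}\log^{1/4}(R).$$ If $\Omega$ is not closed, "touches $\partial\Delta$ at $x$" means that $x$ lies in the closure of the translated copy. -/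

import Mathlib

open MeasureTheory
open scoped Pointwise

noncomputable section

/-- The Euclidean plane `ℝ²`. -/
abbrev Plane : Type := EuclideanSpace ℝ (Fin 2)

/-- The torus `𝕋² = ℝ² / ℤ²`. -/
abbrev Torus : Type := UnitAddTorus (Fin 2)

/-- The translation invariant probability measure on `𝕋²`. -/
def torusMeasure : Measure Torus :=
  Measure.pi fun _ : Fin 2 => (AddCircle.haarAddCircle : Measure UnitAddCircle)

/-- The integer point of the plane with coordinates `k`. -/
def intPoint (k : Fin 2 → ℤ) : Plane := WithLp.toLp 2 fun i => (k i : ℝ)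

/-- The discrepancy `𝒟(RΩ - x)`: the number of integer points in `RΩ - x` minus `R²|Ω|`. -/
def discrepancy (Ω : Set Plane) (R : ℝ) (x : Plane) : ℝ :=
  ({k : Fin 2 → ℤ | intPoint k ∈ (-x) +ᵥ (R • Ω)}.ncard : ℝ) - R ^ 2 * volume.real Ω

/-- The representative in `[0, 1)²` of a point of the torus. -/
def torusRep (t : Torus) : Plane :=
  WithLp.toLp 2 fun i => ((AddCircle.equivIco (1 : ℝ) 0 (t i) : Set.Ico (0 : ℝ) (0 + 1)) : ℝ)

/-- The class modulo `ℤ²` of a point of the plane. -/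
def toTorus (x : Plane) : Torus := fun i => (x i : UnitAddCircle)

/-- The discrepancy, which is a `ℤ²`-periodic function of the translation, on the torus. -/
def torusDiscrepancy (Ω : Set Plane) (R : ℝ) (t : Torus) : ℝ :=
  discrepancy Ω R (torusRep t)

/-- `Ω` can roll unimpeded inside `Δ`: for every point `x` of the boundary of `Δ` some translated
copy of `Ω` is contained in `Δ` and touches the boundary of `Δ` at `x`. (The closure is there
for sets `Ω` that are not closed.) -/
def RollsUnimpededInside (Ω Δ : Set Plane) : Prop :=
  ∀ x ∈ frontier Δ, ∃ v : Plane, v +ᵥ Ω ⊆ Δ ∧ x ∈ closure (v +ᵥ Ω)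

/-- The discrepancy is `ℤ²`-periodic in the translation variable. -/
theorem discrepancy_add_intPoint (Ω : Set Plane) (R : ℝ) (x : Plane) (m : Fin 2 → ℤ) :
    discrepancy Ω R (x + intPoint m) = discrepancy Ω R x := by
  unfold discrepancy
  congr 2
  rw [← Set.ncard_image_of_injective _ (add_left_injective m)]
  congr 1
  ext k
  have key : ∀ j : Fin 2 → ℤ, intPoint (j + m) = intPoint j + intPoint m := by
    intro j
    ext i
    simp [intPoint]
  simp only [Set.mem_image, Set.mem_ofPred_eq, Set.mem_vadd_set_iff_neg_vadd_mem, vadd_eq_add,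
    neg_neg]
  constructor
  · rintro ⟨j, hj, rfl⟩
    rw [key, add_comm (intPoint j), ← add_assoc]
    exact hj
  · intro hk
    refine ⟨k - m, ?_, sub_add_cancel k m⟩
    have := key (k - m)
    rw [sub_add_cancel] at this
    rw [this] at hk
    rwa [add_assoc, add_comm (intPoint m)]

/-- The function on the torus takes at the class of `x` the value `𝒟(RΩ - x)`. -/
theorem torusDiscrepancy_toTorus (Ω : Set Plane) (R : ℝ) (x : Plane) :
    torusDiscrepancy Ω R (toTorus x) = discrepancy Ω R x := by
  have h : ∀ i, ∃ n : ℤ, x i = torusRep (toTorus x) i + n := by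
    intro i
    have h1 : ((torusRep (toTorus x) i : ℝ) : UnitAddCircle) = (x i : UnitAddCircle) := by
      simp only [torusRep, toTorus]
      exact AddCircle.coe_equivIco
    have h2 : ((x i - torusRep (toTorus x) i : ℝ) : UnitAddCircle) = 0 := by
      rw [AddCircle.coe_sub, h1, sub_self]
    obtain ⟨n, hn⟩ := (AddCircle.coe_eq_zero_iff (1 : ℝ)).1 h2
    refine ⟨n, ?_⟩
    rw [zsmul_one] at hn
    rw [hn]
    ring
  choose m hm using h
  have hx : x = torusRep (toTorus x) + intPoint m := by
    ext i
    simpa [intPoint] using hm i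
  unfold torusDiscrepancy
  conv_rhs => rw [hx]
  exact (discrepancy_add_intPoint _ _ _ _).symm

end

open UnitAddTorus ComplexConjugate ENNReal

/-! For m ≠ 0 the m-th Fourier coefficient of the discrepancy of a bounded measurable set K is the
integral of a character over K, because counting lattice points in translates folds the plane onto
the torus. The coefficient at 0 vanishes. Rolling inside a disc of radius r means that at every
supporting line the closure of Ω lies in a tangent disc of radius r (`HasCapRadius`). A chord at
depth s below a supporting line of a body with cap radius ρ therefore has length at most 2√(2ρs).
Chord length is also concave across the body, so second differences with half a period as step bound
the Fourier transform by a multiple of √ρ |m|^(-3/2) (`norm_setIntegral_mFourier_le`). Dilation by R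
turns r into ρ = Rr.

The fourth moment of f is the squared L² norm of f², hence by Parseval the squared ℓ² norm of the
self-convolution of its coefficients. Over ℤ² the convolution of |m|^(-3/2) with itself is O(1/|k|),
and the square of this just fails to be summable: damping beyond frequency N leaves log N
(`tsum_sq_tsum_coeffBound_le`). The result is of order ρ² log N, that is, R² log R when N is of
order R.

The damping comes from averaging over translations in a square of side of order 1/R. Around an
interior point of Ω there is room for a small square, so by convexity RΩ lies between translates of
(R ± 1/R) times the closure of Ω, with a margin for the averaging. The areas change by O(1) only, so
the discrepancy is bounded by two averaged discrepancies plus a constant. If Ω has empty interior,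
it is a null set and its discrepancy vanishes almost everywhere. -/

instance torusMeasure_isProbabilityMeasure : IsProbabilityMeasure torusMeasure := by
  unfold torusMeasure; infer_instance

/-! ### Fourier coefficients on the torus and the fourth moment -/

/-- The Fourier coefficients of a function on the torus. -/
noncomputable def torusCoeff (f : Torus → ℂ) (m : Fin 2 → ℤ) : ℂ :=
  ∫ t, mFourier (-m) t * f t ∂torusMeasure

theorem torusCoeff_congr_ae {f g : Torus → ℂ} (h : f =ᵐ[torusMeasure] g) (m : Fin 2 → ℤ) :
    torusCoeff f m = torusCoeff g m := by
  unfold torusCoeff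
  apply integral_congr_ae
  filter_upwards [h] with t ht
  rw [ht]

theorem hasSum_sq_torusCoeff {f : Torus → ℂ} (hf : MemLp f 2 torusMeasure) :
    HasSum (fun m => ‖torusCoeff f m‖ ^ 2) (∫ t, ‖f t‖ ^ 2 ∂torusMeasure) := by
  have h : HasSum (fun m => ‖torusCoeff (hf.toLp f) m‖ ^ 2)
      (∫ t, ‖(hf.toLp f) t‖ ^ 2 ∂torusMeasure) := hasSum_sq_mFourierCoeff (hf.toLp f)
  simp_rw [torusCoeff_congr_ae hf.coeFn_toLp] at h
  convert h using 1
  apply integral_congr_ae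
  filter_upwards [hf.coeFn_toLp] with t ht
  rw [ht]

theorem hasSum_prod_torusCoeff {f g : Torus → ℂ} (hf : MemLp f 2 torusMeasure)
    (hg : MemLp g 2 torusMeasure) :
    HasSum (fun m => conj (torusCoeff f m) * torusCoeff g m)
      (∫ t, conj (f t) * g t ∂torusMeasure) := by
  have h : HasSum (fun m => conj (torusCoeff (hf.toLp f) m) * torusCoeff (hg.toLp g) m)
      (∫ t, conj ((hf.toLp f) t) * (hg.toLp g) t ∂torusMeasure) :=
    hasSum_prod_mFourierCoeff (hf.toLp f) (hg.toLp g)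
  simp_rw [torusCoeff_congr_ae hf.coeFn_toLp, torusCoeff_congr_ae hg.coeFn_toLp] at h
  convert h using 1
  apply integral_congr_ae
  filter_upwards [hf.coeFn_toLp, hg.coeFn_toLp] with t ht ht'
  rw [ht, ht']

theorem norm_mFourier_apply (m : Fin 2 → ℤ) (t : Torus) : ‖mFourier m t‖ = 1 := by
  simp only [mFourier, ContinuousMap.coe_mk, norm_prod, fourier_apply, Circle.norm_coe,
    Finset.prod_const_one]

theorem memLp_of_bounded {f : Torus → ℂ} {B : ℝ} (hf : AEStronglyMeasurable f torusMeasure)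
    (hB : ∀ t, ‖f t‖ ≤ B) (p : ℝ≥0∞) : MemLp f p torusMeasure :=
  MemLp.of_bound hf B (Filter.Eventually.of_forall hB)

/-- The Fourier coefficients of a square are the self-convolution of the Fourier coefficients. -/
theorem hasSum_torusCoeff_mul_self {f : Torus → ℂ} {B : ℝ}
    (hf : AEStronglyMeasurable f torusMeasure) (hB : ∀ t, ‖f t‖ ≤ B) (k : Fin 2 → ℤ) :
    HasSum (fun m => torusCoeff f (k - m) * torusCoeff f m)
      (torusCoeff (fun t => f t * f t) k) := by
  -- The k-th coefficient of f² is the inner product of the k-th character times conj f with f. The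
  -- m-th coefficient of the former is the conjugate of that of f at k - m, so Parseval gives the
  -- convolution.
  have hmeas : AEStronglyMeasurable (fun t => mFourier k t * conj (f t)) torusMeasure :=
    (mFourier k).continuous.aestronglyMeasurable.mul
      (RCLike.continuous_conj.comp_aestronglyMeasurable hf)
  have hb : ∀ t, ‖mFourier k t * conj (f t)‖ ≤ B := by
    intro t
    rw [norm_mul, norm_mFourier_apply, one_mul, RCLike.norm_conj]
    exact hB t
  have h := hasSum_prod_torusCoeff (memLp_of_bounded hmeas hb 2) (memLp_of_bounded hf hB 2)
  convert h using 1
  · funext m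
    congr 1
    unfold torusCoeff
    rw [← integral_conj]
    congr 1
    funext t
    have : -(k - m) = m + -k := by ring
    rw [this, mFourier_add, mFourier_neg, mFourier_neg]
    simp
    ring
  · unfold torusCoeff
    congr 1
    funext t
    rw [mFourier_neg]
    simp
    ring

/-- Parseval applied to f². Working in `ℝ≥0∞` makes any summability assumption on the majorant
unnecessary. -/
theorem lintegral_enorm_pow_four_le {f : Torus → ℂ} {B : ℝ}
    (hf : AEStronglyMeasurable f torusMeasure) (hB : ∀ t, ‖f t‖ ≤ B)
    {A : (Fin 2 → ℤ) → ℝ≥0∞} (hA : ∀ m, ‖torusCoeff f m‖ₑ ≤ A m) :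
    ∫⁻ t, ‖f t‖ₑ ^ 4 ∂torusMeasure ≤ ∑' k, (∑' m, A (k - m) * A m) ^ 2 := by
  have hm2 : AEStronglyMeasurable (fun t => f t * f t) torusMeasure := hf.mul hf
  have hb2 : ∀ t, ‖f t * f t‖ ≤ B * B := by
    intro t
    rw [norm_mul]
    exact mul_le_mul (hB t) (hB t) (norm_nonneg _) ((norm_nonneg _).trans (hB t))
  have h := hasSum_sq_torusCoeff (memLp_of_bounded hm2 hb2 2)
  have h1 : ∫⁻ t, ‖f t‖ₑ ^ 4 ∂torusMeasure
      = ENNReal.ofReal (∫ t, ‖f t * f t‖ ^ 2 ∂torusMeasure) := by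
    rw [ofReal_integral_eq_lintegral_ofReal]
    · congr 1
      funext t
      rw [ENNReal.ofReal_pow (norm_nonneg _), ofReal_norm, enorm_mul]
      ring
    · exact (memLp_of_bounded hm2 hb2 2).integrable_norm_pow (by norm_num)
    · exact Filter.Eventually.of_forall fun t => by positivity
  rw [h1, ← h.tsum_eq, ENNReal.ofReal_tsum_of_nonneg (fun k => by positivity) h.summable]
  refine ENNReal.tsum_le_tsum fun k => ?_
  rw [ENNReal.ofReal_pow (norm_nonneg _), ofReal_norm]
  gcongr
  rw [← (hasSum_torusCoeff_mul_self hf hB k).tsum_eq]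
  refine enorm_tsum_le_tsum_enorm.trans (ENNReal.tsum_le_tsum fun m => ?_)
  rw [enorm_mul]
  exact mul_le_mul' (hA _) (hA _)

/-! ### Lattice sums of radial weights -/

/-- The sup norm of an integer vector, as a natural number. -/
def supSize (m : Fin 2 → ℤ) : ℕ := max (m 0).natAbs (m 1).natAbs

theorem supSize_le_add_sub (k m : Fin 2 → ℤ) : supSize k ≤ supSize m + supSize (k - m) := by
  simp only [supSize, Pi.sub_apply]
  omega

theorem supSize_neg (m : Fin 2 → ℤ) : supSize (-m) = supSize m := by
  simp [supSize]

theorem supSize_eq_zero {m : Fin 2 → ℤ} : supSize m = 0 ↔ m = 0 := by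
  constructor
  · intro h
    simp only [supSize] at h
    ext i
    fin_cases i <;> simp <;> omega
  · rintro rfl
    simp [supSize]

/-- Spheres of the sup norm are boundaries of squares, so they can be counted exactly; this is why
that norm is used. -/
theorem tsum_ite_supSize_eq {n : ℕ} (hn : n ≠ 0) :
    ∑' m : Fin 2 → ℤ, (if supSize m = n then (1 : ℝ≥0∞) else 0) = 8 * n := by
  rw [← (finTwoArrowEquiv ℤ).symm.tsum_eq]
  rw [tsum_eq_sum (s := (Finset.box n : Finset (ℤ × ℤ)))]
  · rw [Finset.sum_congr rfl (g := fun _ => (1 : ℝ≥0∞))]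
    · rw [Finset.sum_const, Int.card_box hn]
      simp
    · intro x hx
      rw [Int.mem_box] at hx
      simp [supSize, hx]
  · intro x hx
    rw [Int.mem_box] at hx
    simp [supSize, hx]

/-- Sum over shells. The origin is a shell with one point rather than 8 · 0, which is why f must
vanish there. -/
theorem tsum_supSize_eq {f : ℕ → ℝ≥0∞} (h0 : f 0 = 0) :
    ∑' m : Fin 2 → ℤ, f (supSize m) = ∑' n : ℕ, 8 * n * f n := by
  have h1 : ∀ m : Fin 2 → ℤ, f (supSize m) = ∑' n : ℕ, (if supSize m = n then 1 else 0) * f n := by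
    intro m
    rw [tsum_eq_single (supSize m)]
    · simp
    · intro n hn
      simp [hn.symm]
  simp_rw [h1]
  rw [ENNReal.tsum_comm]
  congr 1
  funext n
  rw [ENNReal.tsum_mul_right]
  rcases eq_or_ne n 0 with rfl | hn
  · simp [h0]
  · rw [tsum_ite_supSize_eq hn]

/-- The majorant `n ^ (-3/2)`. -/
noncomputable def decayWeight (n : ℕ) : ℝ := 1 / (n * √n)

/-- The smoothing factor `min 1 (N / n)`. -/
noncomputable def cutoff (N n : ℕ) : ℝ := min 1 (N / n)

/-- Division by zero gives the value that fits: the discrepancy has mean zero, so the frequency 0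
needs no weight. -/
theorem decayWeight_zero : decayWeight 0 = 0 := by simp [decayWeight]

theorem decayWeight_nonneg (n : ℕ) : 0 ≤ decayWeight n := by unfold decayWeight; positivity

theorem cutoff_nonneg (N n : ℕ) : 0 ≤ cutoff N n := by unfold cutoff; positivity

theorem cutoff_le_one (N n : ℕ) : cutoff N n ≤ 1 := min_le_left _ _

/-- Moves the damping from the larger frequency of a convolution pair to their sum k. -/
theorem cutoff_le_of_half {N n k : ℕ} (hn : 0 < n) (hk : 0 < k) (h : k ≤ 2 * n) :
    cutoff N n ≤ 2 * cutoff N k := by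
  unfold cutoff
  rw [mul_min_of_nonneg _ _ (by norm_num : (0:ℝ) ≤ 2)]
  refine min_le_min (by norm_num) ?_
  have hn' : (0 : ℝ) < n := by exact_mod_cast hn
  have hk' : (0 : ℝ) < k := by exact_mod_cast hk
  have h' : (k : ℝ) ≤ 2 * n := by exact_mod_cast h
  rw [← mul_div_assoc, div_le_div_iff₀ hn' hk']
  nlinarith [(Nat.cast_nonneg N : (0 : ℝ) ≤ N)]

/-- Weight of a point `m` of size `n` in the convolution at a point of size `k`, when `m` is the
closer one to the origin. -/
noncomputable def convWeight (k n : ℕ) : ℝ := 4 * decayWeight n * decayWeight (max n k)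

theorem decayWeight_le_of_half {x M : ℕ} (hM : 0 < M) (h : M ≤ 2 * x) :
    decayWeight x ≤ 4 * decayWeight M := by
  unfold decayWeight
  have hx' : (0 : ℝ) < x := by exact_mod_cast (by omega : 0 < x)
  have hM' : (0 : ℝ) < M := by exact_mod_cast hM
  have h' : (M : ℝ) ≤ 2 * x := by exact_mod_cast h
  have hs : √(M : ℝ) ≤ 2 * √x := by
    rw [Real.sqrt_le_left (by positivity), mul_pow, Real.sq_sqrt hx'.le]
    linarith
  have hsM : 0 < √(M : ℝ) := Real.sqrt_pos.2 hM'
  have hsx : 0 < √(x : ℝ) := Real.sqrt_pos.2 hx'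
  rw [mul_one_div, div_le_div_iff₀ (by positivity) (by positivity)]
  have := mul_le_mul h' hs hsM.le (by positivity)
  linarith

/-- The larger of x and y is at least k / 2 and at least the smaller one, so its weight is
controlled by that of max(smaller, k). Keeping the maximum, instead of k alone, makes the later sum
over all shells converge. Adding both terms on the right avoids recording which one is smaller. -/
theorem decayWeight_mul_le {x y k : ℕ} (hk : 0 < k) (h : k ≤ x + y) :
    decayWeight x * decayWeight y ≤ convWeight k x + convWeight k y := by
  have hw : ∀ n, 0 ≤ convWeight k n := fun n =>
    mul_nonneg (mul_nonneg (by norm_num) (decayWeight_nonneg _)) (decayWeight_nonneg _)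
  have key : ∀ {x y : ℕ}, k ≤ x + y → x ≤ y → decayWeight x * decayWeight y ≤ convWeight k x := by
    intro x y h hxy
    have := decayWeight_le_of_half (x := y) (M := max x k) (by omega) (by omega)
    have := mul_le_mul_of_nonneg_left this (decayWeight_nonneg x)
    unfold convWeight
    linarith
  rcases le_total x y with hxy | hxy
  · linarith [key h hxy, hw y]
  · linarith [key (by omega : k ≤ y + x) hxy, hw x, mul_comm (decayWeight x) (decayWeight y)]

/-- Up to k the sum is k^(-3/2) ∑ j^(-1/2) ≤ 2 / k; beyond k the terms are j^(-2), with tail at most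
1 / k. -/
theorem sum_mul_decayWeight_le {k : ℕ} (hk : 0 < k) (n : ℕ) :
    ∑ j ∈ Finset.range (n + 1), j * (decayWeight j * decayWeight (max j k)) ≤ 3 / k := by
  have hk' : (0 : ℝ) < k := by exact_mod_cast hk
  have hsk : 0 < √(k : ℝ) := Real.sqrt_pos.2 hk'
  have hterm : ∀ n : ℕ, ((n + 1 : ℕ) : ℝ) * (decayWeight (n + 1) * decayWeight (max (n + 1) k))
      = 1 / √(n + 1 : ℕ) * decayWeight (max (n + 1) k) := by
    intro n
    have : ((n + 1 : ℕ) : ℝ) ≠ 0 := by positivity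
    rw [← mul_assoc]
    congr 1
    unfold decayWeight
    field_simp
  have h1 : ∀ n ≤ k, ∑ j ∈ Finset.range (n + 1), j * (decayWeight j * decayWeight (max j k))
      ≤ 2 * √n * decayWeight k := by
    intro n
    induction n with
    | zero => intro _; simp
    | succ n ih =>
      intro hn
      rw [Finset.sum_range_succ, hterm, max_eq_right hn]
      have h2 : 1 / √((n + 1 : ℕ) : ℝ) ≤ 2 * √((n + 1 : ℕ) : ℝ) - 2 * √n := by
        have ha : 0 < √((n + 1 : ℕ) : ℝ) := Real.sqrt_pos.2 (by positivity)
        have hb : 0 ≤ √(n : ℝ) := Real.sqrt_nonneg _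
        have ha2 : √((n + 1 : ℕ) : ℝ) ^ 2 = n + 1 := by
          rw [Real.sq_sqrt (by positivity)]; push_cast; ring
        have hb2 : √(n : ℝ) ^ 2 = n := Real.sq_sqrt (by positivity)
        rw [div_le_iff₀ ha]
        nlinarith [sq_nonneg (√((n + 1 : ℕ) : ℝ) - √(n : ℝ))]
      nlinarith [ih (by omega), mul_le_mul_of_nonneg_right h2 (decayWeight_nonneg k)]
  -- The subtracted term is the part of the tail not yet used, so that the induction telescopes.
  have h2 : ∀ n : ℕ, ∑ j ∈ Finset.range (k + n + 1), j * (decayWeight j * decayWeight (max j k))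
      ≤ 3 / k - 1 / (k + n : ℕ) := by
    intro n
    induction n with
    | zero =>
      refine (h1 k le_rfl).trans (le_of_eq ?_)
      unfold decayWeight
      simp only [add_zero]
      field_simp
      norm_num
    | succ n ih =>
      rw [← add_assoc, Finset.sum_range_succ, hterm, max_eq_left (by omega)]
      have hp : (0 : ℝ) < (k + n : ℕ) := by exact_mod_cast (by omega : 0 < k + n)
      have h3 : 1 / √((k + n + 1 : ℕ) : ℝ) * decayWeight (k + n + 1)
          ≤ 1 / (k + n : ℕ) - 1 / (k + n + 1 : ℕ) := by
        have hq : (0 : ℝ) < (k + n + 1 : ℕ) := by positivity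
        have hs2 := Real.mul_self_sqrt hq.le
        have : 1 / √((k + n + 1 : ℕ) : ℝ) * decayWeight (k + n + 1)
            = 1 / (((k + n + 1 : ℕ) : ℝ) * ((k + n + 1 : ℕ) : ℝ)) := by
          unfold decayWeight
          rw [div_mul_div_comm, one_mul]
          congr 1
          nth_rewrite 4 [← hs2]
          ring
        rw [this, div_sub_div _ _ hp.ne' hq.ne']
        rw [div_le_div_iff₀ (by positivity) (by positivity)]
        push_cast at hp hq ⊢
        nlinarith [mul_pos hp hq]
      linarith
  rcases le_total n k with hn | hn
  · have hs : √(n : ℝ) ≤ √k := Real.sqrt_le_sqrt (by exact_mod_cast hn)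
    have h3 : 2 * √k * decayWeight k = 2 / k := by
      unfold decayWeight
      field_simp
    have h4 : (2 : ℝ) / k ≤ 3 / k := by gcongr; norm_num
    nlinarith [h1 n hn, mul_le_mul_of_nonneg_right hs (decayWeight_nonneg k)]
  · obtain ⟨j, rfl⟩ := Nat.exists_eq_add_of_le hn
    have : (0 : ℝ) ≤ 1 / (k + j : ℕ) := by positivity
    linarith [h2 j]

/-- Harmonic sum up to N, which gives 1 + log N, and a tail of terms N / j² beyond N, which adds at
most 1. -/
theorem sum_cutoff_div_le {N : ℕ} (hN : 0 < N) (n : ℕ) :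
    ∑ j ∈ Finset.range (n + 1), cutoff N j / j ≤ 2 + Real.log N := by
  have hN' : (0 : ℝ) < N := by exact_mod_cast hN
  have hnn : ∀ j : ℕ, 0 ≤ cutoff N j / j := fun j => div_nonneg (cutoff_nonneg _ _) (by positivity)
  have h1 : ∑ j ∈ Finset.range (N + 1), cutoff N j / j ≤ 1 + Real.log N := by
    refine le_trans ?_ (harmonic_le_one_add_log N)
    have h0 : cutoff N 0 / ((0 : ℕ) : ℝ) = 0 := by simp
    rw [Finset.sum_range_succ', harmonic, h0, add_zero]
    push_cast
    refine Finset.sum_le_sum fun j _ => ?_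
    rw [div_eq_mul_inv]
    have := cutoff_le_one N (j + 1)
    nlinarith [inv_nonneg.2 (by positivity : (0 : ℝ) ≤ j + 1)]
  have h2 : ∀ n : ℕ, ∑ j ∈ Finset.range (N + n + 1), cutoff N j / j
      ≤ 2 + Real.log N - N / (N + n : ℕ) := by
    intro n
    induction n with
    | zero =>
      simp only [add_zero]
      rw [div_self hN'.ne']
      linarith
    | succ n ih =>
      rw [← add_assoc, Finset.sum_range_succ]
      have hp : (0 : ℝ) < (N + n : ℕ) := by exact_mod_cast (by omega : 0 < N + n)
      have h3 : cutoff N (N + n + 1) / (N + n + 1 : ℕ) ≤ N / (N + n : ℕ) - N / (N + n + 1 : ℕ) := by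
        have hq : (0 : ℝ) < (N + n + 1 : ℕ) := by positivity
        have : cutoff N (N + n + 1) ≤ N / (N + n + 1 : ℕ) := min_le_right _ _
        refine (div_le_div_of_nonneg_right this hq.le).trans ?_
        rw [div_div, div_sub_div _ _ hp.ne' hq.ne']
        rw [div_le_div_iff₀ (by positivity) (by positivity)]
        push_cast at hp hq ⊢
        nlinarith [mul_pos hp hq, mul_pos hN' hp, mul_pos hN' hq, mul_pos hN' (mul_pos hp hq)]
      linarith
  have h3 : ∑ j ∈ Finset.range (n + 1), cutoff N j / j
      ≤ ∑ j ∈ Finset.range (N + n + 1), cutoff N j / j :=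
    Finset.sum_le_sum_of_subset_of_nonneg (Finset.range_mono (by omega)) fun j _ _ => hnn j
  have : (0 : ℝ) ≤ N / (N + n : ℕ) := by positivity
  linarith [h2 n]

/-- The majorant for the Fourier coefficients of a smoothed discrepancy. -/
noncomputable def coeffBound (N n : ℕ) : ℝ := decayWeight n * cutoff N n

theorem coeffBound_nonneg (N n : ℕ) : 0 ≤ coeffBound N n :=
  mul_nonneg (decayWeight_nonneg _) (cutoff_nonneg _ _)

theorem coeffBound_le (N n : ℕ) : coeffBound N n ≤ decayWeight n :=
  mul_le_of_le_one_right (decayWeight_nonneg _) (cutoff_le_one _ _)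

/-- Only the damping of the larger frequency is kept, as it is comparable to that of k; the other
cutoff is bounded by 1. -/
theorem coeffBound_mul_le {N x y k : ℕ} (hk : 0 < k) (h : k ≤ x + y) :
    coeffBound N x * coeffBound N y
      ≤ 2 * cutoff N k * convWeight k x + 2 * cutoff N k * convWeight k y := by
  have key : ∀ {x y : ℕ}, k ≤ x + y → x ≤ y →
      coeffBound N x * coeffBound N y ≤ 2 * cutoff N k * (decayWeight x * decayWeight y) := by
    intro x y h hxy
    have h1 := cutoff_le_of_half (N := N) (n := y) (k := k) (by omega) hk (by omega)
    calc coeffBound N x * coeffBound N y ≤ decayWeight x * (decayWeight y * (2 * cutoff N k)) :=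
          mul_le_mul (coeffBound_le _ _) (mul_le_mul_of_nonneg_left h1 (decayWeight_nonneg _))
            (coeffBound_nonneg _ _) (decayWeight_nonneg _)
      _ = _ := by ring
  have h2 : coeffBound N x * coeffBound N y
      ≤ 2 * cutoff N k * (decayWeight x * decayWeight y) := by
    rcases le_total x y with hxy | hxy
    · exact key h hxy
    · rw [mul_comm, mul_comm (decayWeight x)]
      exact key (by omega) hxy
  rw [← mul_add]
  exact h2.trans (mul_le_mul_of_nonneg_left (decayWeight_mul_le hk h)
    (mul_nonneg (by norm_num) (cutoff_nonneg _ _)))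

theorem tsum_le_ofReal_of_sum_range_le {f : ℕ → ℝ} (hf : ∀ n, 0 ≤ f n) {C : ℝ}
    (h : ∀ n, ∑ j ∈ Finset.range (n + 1), f j ≤ C) :
    ∑' n, ENNReal.ofReal (f n) ≤ ENNReal.ofReal C := by
  refine ENNReal.tsum_le_of_sum_range_le fun n => ?_
  rw [← ENNReal.ofReal_sum_of_nonneg fun j _ => hf j]
  apply ENNReal.ofReal_le_ofReal
  refine le_trans ?_ (h n)
  rw [Finset.sum_range_succ]
  linarith [hf n]

theorem tsum_supSize_ofReal_le {f : ℕ → ℝ} (hf : ∀ n, 0 ≤ f n) (h0 : f 0 = 0) {C : ℝ}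
    (h : ∀ n, ∑ j ∈ Finset.range (n + 1), j * f j ≤ C) :
    ∑' m : Fin 2 → ℤ, ENNReal.ofReal (f (supSize m)) ≤ ENNReal.ofReal (8 * C) := by
  rw [tsum_supSize_eq (f := fun n => ENNReal.ofReal (f n)) (by simp [h0])]
  have : ∀ n : ℕ, 8 * (n : ℝ≥0∞) * ENNReal.ofReal (f n) = ENNReal.ofReal (8 * (n * f n)) := by
    intro n
    rw [ENNReal.ofReal_mul (by norm_num), ENNReal.ofReal_mul (by positivity),
      ENNReal.ofReal_natCast, mul_assoc]
    norm_num
  simp_rw [this]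
  refine tsum_le_ofReal_of_sum_range_le
    (fun n => mul_nonneg (by norm_num) (mul_nonneg (by positivity) (hf n))) fun n => ?_
  rw [← Finset.mul_sum]
  linarith [h n]

/-- The reflection m ↦ k - m exchanges the two halves of the majorant, and each is a radial sum. The
constant is 2 · 8 · (2 · 4) · 3: two halves, the shell count, the losses from cutoff and decay, and
the factor 3 / k. -/
theorem tsum_coeffBound_mul_le (N : ℕ) {k : Fin 2 → ℤ} (hk : k ≠ 0) :
    ∑' m, ENNReal.ofReal (coeffBound N (supSize (k - m))) * ENNReal.ofReal (coeffBound N (supSize m))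
      ≤ ENNReal.ofReal (384 * (cutoff N (supSize k) / supSize k)) := by
  have hk' : 0 < supSize k := Nat.pos_of_ne_zero (mt supSize_eq_zero.1 hk)
  set K := supSize k
  have hnn : ∀ n, 0 ≤ 2 * cutoff N K * convWeight K n := fun n =>
    mul_nonneg (mul_nonneg (by norm_num) (cutoff_nonneg _ _))
      (mul_nonneg (mul_nonneg (by norm_num) (decayWeight_nonneg _)) (decayWeight_nonneg _))
  have hone : ∑' m, ENNReal.ofReal (2 * cutoff N K * convWeight K (supSize m))
      ≤ ENNReal.ofReal (8 * (8 * cutoff N K * (3 / K))) := by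
    refine tsum_supSize_ofReal_le (f := fun n => 2 * cutoff N K * convWeight K n) hnn
      (by simp [convWeight, decayWeight_zero]) fun n => ?_
    have := mul_le_mul_of_nonneg_left (sum_mul_decayWeight_le hk' n)
      (mul_nonneg (by norm_num : (0 : ℝ) ≤ 8) (cutoff_nonneg N K))
    rw [Finset.mul_sum] at this
    refine le_trans (le_of_eq (Finset.sum_congr rfl fun j _ => ?_)) this
    unfold convWeight
    ring
  have htwo : ∑' m, ENNReal.ofReal (2 * cutoff N K * convWeight K (supSize (k - m)))
      ≤ ENNReal.ofReal (8 * (8 * cutoff N K * (3 / K))) := by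
    exact ((Equiv.subLeft k).tsum_eq fun m =>
      ENNReal.ofReal (2 * cutoff N K * convWeight K (supSize m))).trans_le hone
  calc _ ≤ ∑' m, (ENNReal.ofReal (2 * cutoff N K * convWeight K (supSize (k - m)))
        + ENNReal.ofReal (2 * cutoff N K * convWeight K (supSize m))) := by
        refine ENNReal.tsum_le_tsum fun m => ?_
        rw [← ENNReal.ofReal_mul (coeffBound_nonneg _ _), ← ENNReal.ofReal_add (hnn _) (hnn _)]
        refine ENNReal.ofReal_le_ofReal (coeffBound_mul_le hk' ?_)
        rw [add_comm]
        exact supSize_le_add_sub k m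
    _ ≤ _ := by
        rw [ENNReal.tsum_add]
        refine (add_le_add htwo hone).trans (le_of_eq ?_)
        have := cutoff_nonneg N K
        rw [← ENNReal.ofReal_add (by positivity) (by positivity)]
        congr 1
        ring

theorem tsum_coeffBound_mul_self_le (N : ℕ) :
    ∑' m : Fin 2 → ℤ, ENNReal.ofReal (coeffBound N (supSize (0 - m))) *
      ENNReal.ofReal (coeffBound N (supSize m)) ≤ ENNReal.ofReal 24 := by
  have h1 : ∀ m : Fin 2 → ℤ, ENNReal.ofReal (coeffBound N (supSize (0 - m))) *
      ENNReal.ofReal (coeffBound N (supSize m))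
      ≤ ENNReal.ofReal (decayWeight (supSize m) * decayWeight (supSize m)) := by
    intro m
    rw [zero_sub, supSize_neg, ← ENNReal.ofReal_mul (coeffBound_nonneg _ _)]
    exact ENNReal.ofReal_le_ofReal (mul_le_mul (coeffBound_le _ _) (coeffBound_le _ _)
      (coeffBound_nonneg _ _) (decayWeight_nonneg _))
  refine (ENNReal.tsum_le_tsum h1).trans ?_
  have := tsum_supSize_ofReal_le (f := fun n => decayWeight n * decayWeight n) (C := 3)
    (fun n => mul_self_nonneg _) (by simp [decayWeight_zero]) fun n => by
      have h := sum_mul_decayWeight_le one_pos n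
      rw [Nat.cast_one, div_one] at h
      refine le_trans (Finset.sum_le_sum fun j _ => ?_) h
      rcases Nat.eq_zero_or_pos j with rfl | hj
      · simp
      · rw [max_eq_left hj]
  exact this.trans (ENNReal.ofReal_le_ofReal (by norm_num))

/-- The fourth moment of a trigonometric series with coefficients of size `|m| ^ (-3/2)` up to `N`
grows logarithmically in `N`. -/
theorem tsum_sq_tsum_coeffBound_le {N : ℕ} (hN : 0 < N) :
    ∑' k : Fin 2 → ℤ, (∑' m, ENNReal.ofReal (coeffBound N (supSize (k - m))) *
      ENNReal.ofReal (coeffBound N (supSize m))) ^ 2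
      ≤ ENNReal.ofReal (24 ^ 2 + 8 * (384 ^ 2 * (2 + Real.log N))) := by
  -- The frequency k = 0 is treated apart: the bound by 1 / |k| has value 0 there, while the true
  -- convolution is a sum of squares.
  have hlog : 0 ≤ Real.log N := Real.log_natCast_nonneg N
  have hterm : ∀ k : Fin 2 → ℤ, (∑' m, ENNReal.ofReal (coeffBound N (supSize (k - m))) *
      ENNReal.ofReal (coeffBound N (supSize m))) ^ 2
      ≤ (if k = 0 then ENNReal.ofReal (24 ^ 2) else 0)
        + ENNReal.ofReal ((384 * (cutoff N (supSize k) / supSize k)) ^ 2) := by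
    intro k
    by_cases hk : k = 0
    · subst hk
      rw [if_pos rfl, ENNReal.ofReal_pow (by norm_num)]
      exact le_add_right (pow_le_pow_left' (tsum_coeffBound_mul_self_le N) 2)
    · rw [if_neg hk, zero_add, ENNReal.ofReal_pow (by have := cutoff_nonneg N (supSize k); positivity)]
      exact pow_le_pow_left' (tsum_coeffBound_mul_le N hk) 2
  refine (ENNReal.tsum_le_tsum hterm).trans ?_
  rw [ENNReal.tsum_add, tsum_ite_eq, ENNReal.ofReal_add (by positivity) (by positivity)]
  gcongr
  refine tsum_supSize_ofReal_le (f := fun n => (384 * (cutoff N n / n)) ^ 2)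
    (fun n => sq_nonneg _) (by simp) fun n => ?_
  have := mul_le_mul_of_nonneg_left (sum_cutoff_div_le hN n) (by norm_num : (0 : ℝ) ≤ 384 ^ 2)
  rw [Finset.mul_sum] at this
  refine le_trans (Finset.sum_le_sum fun j _ => ?_) this
  rcases Nat.eq_zero_or_pos j with rfl | hj
  · simp
  · have hj' : (0 : ℝ) < j := by exact_mod_cast hj
    -- A shell of about j points times 1 / j² leaves 1 / j, the source of the logarithm. One of the
    -- two cutoff factors suffices.
    have h1 : (j : ℝ) * (384 * (cutoff N j / j)) ^ 2 = 384 ^ 2 * (cutoff N j * (cutoff N j / j)) := by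
      field_simp
    rw [h1]
    have := div_nonneg (cutoff_nonneg N j) hj'.le
    have := mul_le_mul_of_nonneg_right (cutoff_le_one N j) this
    linarith

/-! ### Averaging over small squares -/

/-- The class of a pair of real numbers on the torus. -/
def torusClass (h : Fin 2 → ℝ) : Torus := fun i => (h i : UnitAddCircle)

theorem continuous_torusClass : Continuous torusClass :=
  continuous_pi fun i => (AddCircle.continuous_mk' 1).comp (continuous_apply i)

instance torusMeasure_isAddLeftInvariant : torusMeasure.IsAddLeftInvariant := by
  unfold torusMeasure; infer_instance

/-- The uniform probability measure on `[-ε, ε]`. -/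
noncomputable def intervalUniform (ε : ℝ) : Measure ℝ :=
  (ENNReal.ofReal (2 * ε))⁻¹ • volume.restrict (Set.Ioc (-ε) ε)

theorem intervalUniform_isProbabilityMeasure {ε : ℝ} (hε : 0 < ε) :
    IsProbabilityMeasure (intervalUniform ε) := by
  constructor
  unfold intervalUniform
  rw [Measure.smul_apply, Measure.restrict_apply_univ, Real.volume_Ioc, smul_eq_mul]
  have : ε - -ε = 2 * ε := by ring
  rw [this]
  exact ENNReal.inv_mul_cancel (by simpa using hε) ENNReal.ofReal_ne_top

theorem norm_integral_fourier_intervalUniform_le {ε : ℝ} (hε : 0 < ε) (n : ℤ) (hn : n ≠ 0) :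
    ‖∫ s, fourier n (s : UnitAddCircle) ∂(intervalUniform ε)‖ ≤ 1 / (ε * |(n : ℝ)|) := by
  unfold intervalUniform
  rw [integral_smul_measure, ← intervalIntegral.integral_of_le (by linarith)]
  have hc : (2 * Real.pi * Complex.I * n : ℂ) ≠ 0 := by
    have : (n : ℂ) ≠ 0 := by exact_mod_cast hn
    simp [Real.pi_ne_zero, this]
  have h1 : ∀ s : ℝ, fourier n (s : UnitAddCircle)
      = Complex.exp ((2 * Real.pi * Complex.I * n : ℂ) * s) := by
    intro s
    rw [fourier_coe_apply]
    simp
  simp_rw [h1]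
  rw [integral_exp_mul_complex hc, norm_smul, norm_div]
  have h2 : ∀ x : ℝ, ‖Complex.exp ((2 * Real.pi * Complex.I * n : ℂ) * x)‖ = 1 := by
    intro x
    have : (2 * Real.pi * Complex.I * n : ℂ) * x = ((2 * Real.pi * n * x : ℝ) : ℂ) * Complex.I := by
      push_cast; ring
    rw [this, Complex.norm_exp_ofReal_mul_I]
  have h3 := norm_sub_le (Complex.exp ((2 * Real.pi * Complex.I * n : ℂ) * (ε : ℝ)))
    (Complex.exp ((2 * Real.pi * Complex.I * n : ℂ) * ((-ε : ℝ) : ℂ)))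
  rw [h2, h2] at h3
  have h4 : ‖(2 * Real.pi * Complex.I * n : ℂ)‖ = 2 * Real.pi * |(n : ℝ)| := by
    simp [abs_of_pos Real.pi_pos]
  rw [h4, ENNReal.toReal_inv, ENNReal.toReal_ofReal (by linarith), Real.norm_of_nonneg (by positivity)]
  have hn' : 0 < |(n : ℝ)| := abs_pos.2 (by exact_mod_cast hn)
  have hpi := Real.pi_gt_three
  calc _ ≤ (2 * ε)⁻¹ * ((1 + 1) / (2 * Real.pi * |(n : ℝ)|)) := by gcongr
    _ ≤ (2 * ε)⁻¹ * ((1 + 1) / (1 * |(n : ℝ)|)) := by gcongr; linarith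
    _ = _ := by field_simp; norm_num

/-- The uniform probability measure on `[-ε, ε]²`. -/
noncomputable def boxUniform (ε : ℝ) : Measure (Fin 2 → ℝ) := Measure.pi fun _ => intervalUniform ε

theorem boxUniform_isProbabilityMeasure {ε : ℝ} (hε : 0 < ε) :
    IsProbabilityMeasure (boxUniform ε) := by
  have := intervalUniform_isProbabilityMeasure hε
  unfold boxUniform
  infer_instance

theorem ae_boxUniform_mem {ε : ℝ} (hε : 0 < ε) : ∀ᵐ h ∂(boxUniform ε), ∀ i, |h i| ≤ ε := by
  have := intervalUniform_isProbabilityMeasure hε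
  rw [ae_all_iff]
  intro i
  refine (Measure.tendsto_eval_ae_ae (μ := fun _ : Fin 2 => intervalUniform ε) (i := i)).eventually
    (p := fun s => |s| ≤ ε) ?_
  unfold intervalUniform
  refine Measure.ae_smul_measure ?_ _
  filter_upwards [ae_restrict_mem measurableSet_Ioc] with s hs
  rw [abs_le]
  exact ⟨hs.1.le, hs.2⟩

/-- The integral factors over the coordinates. The coordinate realizing the sup norm supplies the
decay, and the other factor is at most 1. -/
theorem norm_integral_mFourier_boxUniform_le {ε : ℝ} (hε : 0 < ε) {N : ℕ} (hN : 1 / ε ≤ N)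
    {m : Fin 2 → ℤ} (hm : m ≠ 0) :
    ‖∫ h, mFourier m (torusClass h) ∂(boxUniform ε)‖ ≤ cutoff N (supSize m) := by
  have := intervalUniform_isProbabilityMeasure hε
  have h1 : ∀ i, ‖∫ s, fourier (m i) (s : UnitAddCircle) ∂(intervalUniform ε)‖ ≤ 1 := by
    intro i
    refine (norm_integral_le_integral_norm _).trans ?_
    simp only [fourier_apply, Circle.norm_coe, integral_const, probReal_univ, smul_eq_mul, mul_one,
      le_refl]
  have h2 : ∀ i, (m i).natAbs = supSize m →
      ‖∫ s, fourier (m i) (s : UnitAddCircle) ∂(intervalUniform ε)‖ ≤ cutoff N (supSize m) := by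
    intro i hi
    refine le_min (h1 i) ?_
    have h0 : m i ≠ 0 := by
      intro h
      rw [h] at hi
      exact hm (supSize_eq_zero.1 hi.symm)
    refine (norm_integral_fourier_intervalUniform_le hε _ h0).trans ?_
    rw [← hi, Nat.cast_natAbs, Int.cast_abs, ← div_div]
    gcongr
  have h3 : ∫ h, mFourier m (torusClass h) ∂(boxUniform ε)
      = ∏ i, ∫ s, fourier (m i) (s : UnitAddCircle) ∂(intervalUniform ε) :=
    integral_fintype_prod_eq_prod (μ := fun _ : Fin 2 => intervalUniform ε)
      (fun i (s : ℝ) => (fourier (m i) (s : UnitAddCircle) : ℂ))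
  rw [h3, Fin.prod_univ_two, norm_mul]
  have hc := cutoff_nonneg N (supSize m)
  rcases max_choice (m 0).natAbs (m 1).natAbs with h | h
  · calc _ ≤ cutoff N (supSize m) * 1 := mul_le_mul (h2 0 h.symm) (h1 1) (norm_nonneg _) hc
      _ = _ := mul_one _
  · calc _ ≤ 1 * cutoff N (supSize m) := mul_le_mul (h1 0) (h2 1 h.symm) (norm_nonneg _) zero_le_one
      _ = _ := one_mul _

/-- The average of the translates of a function on the torus by a measure. -/
noncomputable def torusAverage (ν : Measure (Fin 2 → ℝ)) (f : Torus → ℂ) (t : Torus) : ℂ :=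
  ∫ h, f (t + torusClass h) ∂ν

theorem norm_torusAverage_le {ν : Measure (Fin 2 → ℝ)} [IsProbabilityMeasure ν] {f : Torus → ℂ}
    {B : ℝ} (hB : ∀ t, ‖f t‖ ≤ B) (t : Torus) : ‖torusAverage ν f t‖ ≤ B := by
  unfold torusAverage
  refine (norm_integral_le_of_norm_le_const (Filter.Eventually.of_forall fun h => hB _)).trans ?_
  simp

theorem stronglyMeasurable_torusAverage {ν : Measure (Fin 2 → ℝ)} [SFinite ν] {f : Torus → ℂ}
    (hf : Measurable f) :
    StronglyMeasurable (torusAverage ν f) := by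
  unfold torusAverage
  refine StronglyMeasurable.integral_prod_right' (f := fun p : Torus × (Fin 2 → ℝ) =>
    f (p.1 + torusClass p.2)) ?_
  refine (hf.comp ?_).stronglyMeasurable
  exact measurable_fst.add (continuous_torusClass.measurable.comp measurable_snd)

/-- Fubini and translation invariance: averaging is a convolution, hence a multiplier on Fourier
coefficients. -/
theorem torusCoeff_torusAverage {ν : Measure (Fin 2 → ℝ)} [IsProbabilityMeasure ν] {f : Torus → ℂ}
    {B : ℝ} (hf : Measurable f) (hB : ∀ t, ‖f t‖ ≤ B) (m : Fin 2 → ℤ) :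
    torusCoeff (torusAverage ν f) m = torusCoeff f m * ∫ h, mFourier m (torusClass h) ∂ν := by
  unfold torusCoeff torusAverage
  simp_rw [← integral_const_mul]
  rw [integral_integral_swap]
  · congr 1
    funext h
    rw [← integral_add_right_eq_self (μ := torusMeasure)
      (fun t => mFourier (-m) t * f t) (torusClass h), mul_comm, ← integral_const_mul]
    congr 1
    funext t
    have h1 : mFourier (-m) (t + torusClass h) = mFourier (-m) t * mFourier (-m) (torusClass h) := by
      simp only [mFourier, ContinuousMap.coe_mk, Pi.add_apply, fourier_apply, smul_add,
        AddCircle.toCircle_add, Circle.coe_mul, Finset.prod_mul_distrib]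
    have h2 : mFourier m (torusClass h) * mFourier (-m) (torusClass h) = 1 := by
      rw [← mFourier_add, add_neg_cancel, mFourier_zero]
      rfl
    rw [h1]
    linear_combination (-(mFourier (-m) t * f (t + torusClass h))) * h2
  · refine Integrable.of_bound (C := B) ?_ (Filter.Eventually.of_forall ?_)
    · refine Measurable.aestronglyMeasurable ?_
      refine ((mFourier (-m)).continuous.measurable.comp measurable_fst).mul (hf.comp ?_)
      exact measurable_fst.add (continuous_torusClass.measurable.comp measurable_snd)
    · rintro ⟨t, h⟩
      simp only [Function.uncurry, norm_mul, norm_mFourier_apply, one_mul]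
      exact hB _

/-! ### Lattice counts and the Fourier coefficients of the discrepancy -/

theorem discrepancy_eq (Ω : Set Plane) (R : ℝ) (x : Plane) :
    discrepancy Ω R x = ({k | x + intPoint k ∈ R • Ω}.ncard : ℝ) - R ^ 2 * volume.real Ω := by
  unfold discrepancy
  congr 3
  ext k
  rw [Set.mem_ofPred_eq, Set.mem_vadd_set_iff_neg_vadd_mem, neg_neg, vadd_eq_add, Set.mem_ofPred_eq]

/-- Scale 1 with arbitrary K is the working form, since the comparison bodies are not dilates of Ω
by R. -/
theorem discrepancy_one_eq (K : Set Plane) (x : Plane) :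
    discrepancy K 1 x = ({k | x + intPoint k ∈ K}.ncard : ℝ) - volume.real K := by
  rw [discrepancy_eq, one_smul, one_pow, one_mul]

/-- Uniformity in x over the unit square turns the count into one fixed finite sum of indicators,
which yields measurability and boundedness. -/
theorem exists_finset_lattice_subset {K : Set Plane} (hK : Bornology.IsBounded K) :
    ∃ S : Finset (Fin 2 → ℤ), ∀ x : Plane, (∀ i, x i ∈ Set.Icc (0 : ℝ) 1) →
      ∀ k, x + intPoint k ∈ K → k ∈ S := by
  obtain ⟨M, hM⟩ := hK.subset_closedBall 0
  refine ⟨Fintype.piFinset fun _ => Finset.Icc (-⌈M + 1⌉) ⌈M + 1⌉, fun x hx k hk => ?_⟩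
  rw [Fintype.mem_piFinset]
  intro i
  have h1 := hM hk
  rw [mem_closedBall_zero_iff] at h1
  have h2 := (PiLp.norm_apply_le (x + intPoint k) i).trans h1
  have h3 : (x + intPoint k) i = x i + k i := rfl
  rw [h3, Real.norm_eq_abs, abs_le] at h2
  have h4 := Int.le_ceil (M + 1)
  have h5 := hx i
  rw [Finset.mem_Icc]
  constructor
  · have : (-⌈M + 1⌉ : ℝ) ≤ (k i : ℝ) := by linarith [h5.2]
    exact_mod_cast this
  · have : (k i : ℝ) ≤ (⌈M + 1⌉ : ℝ) := by linarith [h5.1]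
    exact_mod_cast this

theorem ncard_eq_sum_indicator {K : Set Plane} {S : Finset (Fin 2 → ℤ)} {x : Plane}
    (hS : ∀ k, x + intPoint k ∈ K → k ∈ S) :
    ({k | x + intPoint k ∈ K}.ncard : ℝ)
      = ∑ k ∈ S, K.indicator (fun _ => (1 : ℝ)) (x + intPoint k) := by
  classical
  have : {k | x + intPoint k ∈ K} = (S.filter fun k => x + intPoint k ∈ K : Finset _) := by
    ext k
    simp only [Set.mem_ofPred_eq, Finset.coe_filter]
    exact ⟨fun h => ⟨hS k h, h⟩, fun h => h.2⟩
  rw [this, Set.ncard_coe_finset, Finset.card_filter]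
  push_cast
  refine Finset.sum_congr rfl fun k _ => ?_
  rw [Set.indicator_apply]

theorem finite_lattice {K : Set Plane} (hK : Bornology.IsBounded K) (x : Plane) :
    {k | x + intPoint k ∈ K}.Finite := by
  have hb : Bornology.IsBounded ((-x) +ᵥ K) := hK.vadd (-x)
  obtain ⟨S, hS⟩ := exists_finset_lattice_subset hb
  refine S.finite_toSet.subset fun k hk => hS 0 (fun i => by simp) k ?_
  rw [Set.mem_vadd_set_iff_neg_vadd_mem, neg_neg, vadd_eq_add, zero_add]
  exact hk

theorem torusRep_mem (t : Torus) (i : Fin 2) : torusRep t i ∈ Set.Icc (0 : ℝ) 1 := by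
  have h : torusRep t i ∈ Set.Ico (0 : ℝ) (0 + 1) := (AddCircle.equivIco (1 : ℝ) 0 (t i)).2
  rw [zero_add] at h
  exact ⟨h.1, h.2.le⟩

theorem measurable_torusRep : Measurable torusRep := by
  unfold torusRep
  refine (WithLp.measurable_toLp 2 _).comp (measurable_pi_lambda _ fun i => ?_)
  exact measurable_subtype_coe.comp
    ((AddCircle.measurableEquivIco (1 : ℝ) 0).measurable.comp (measurable_pi_apply i))

theorem toTorus_torusRep (t : Torus) : toTorus (torusRep t) = t := by
  funext i
  exact AddCircle.coe_equivIco

theorem torusDiscrepancy_one_eq_sum {K : Set Plane} (hK : Bornology.IsBounded K) :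
    ∃ S : Finset (Fin 2 → ℤ), ∀ t, torusDiscrepancy K 1 t
      = ∑ k ∈ S, K.indicator (fun _ => (1 : ℝ)) (torusRep t + intPoint k) - volume.real K := by
  obtain ⟨S, hS⟩ := exists_finset_lattice_subset hK
  refine ⟨S, fun t => ?_⟩
  unfold torusDiscrepancy
  rw [discrepancy_one_eq, ncard_eq_sum_indicator (hS _ (torusRep_mem t))]

theorem measurable_torusDiscrepancy_one {K : Set Plane} (hK : Bornology.IsBounded K)
    (hm : MeasurableSet K) : Measurable (torusDiscrepancy K 1) := by
  obtain ⟨S, hS⟩ := torusDiscrepancy_one_eq_sum hK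
  rw [funext hS]
  refine (Finset.measurable_sum _ fun k _ => ?_).sub_const _
  exact (measurable_const.indicator hm).comp (measurable_torusRep.add_const _)

theorem exists_bound_torusDiscrepancy_one {K : Set Plane} (hK : Bornology.IsBounded K) :
    ∃ B, ∀ t, |torusDiscrepancy K 1 t| ≤ B := by
  obtain ⟨S, hS⟩ := torusDiscrepancy_one_eq_sum hK
  refine ⟨∑ k ∈ S, 1 + volume.real K, fun t => ?_⟩
  rw [hS]
  refine (abs_sub _ _).trans (add_le_add ((Finset.abs_sum_le_sum_abs _ _).trans
    (Finset.sum_le_sum fun k _ => ?_)) (abs_of_nonneg measureReal_nonneg).le)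
  by_cases h : torusRep t + intPoint k ∈ K <;> simp [h]

theorem mFourier_toTorus_add_intPoint (m k : Fin 2 → ℤ) (x : Plane) :
    mFourier m (toTorus (x + intPoint k)) = mFourier m (toTorus x) := by
  congr 1
  funext i
  have : (x + intPoint k) i = x i + (k i : ℝ) := rfl
  simp only [toTorus, this, AddCircle.coe_add]
  have h : (((k i : ℝ)) : UnitAddCircle) = 0 :=
    (AddCircle.coe_eq_zero_iff (1 : ℝ)).2 ⟨k i, by simp⟩
  rw [h, add_zero]

theorem continuous_toTorus : Continuous toTorus :=
  continuous_pi fun i => (AddCircle.continuous_mk' 1).comp (by fun_prop)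

/-- The unit cell translated by an integer vector. -/
def unitCell (k : Fin 2 → ℤ) : Set Plane := {x | ∀ i, x i ∈ Set.Ioc (k i : ℝ) (k i + 1)}

theorem measurableSet_unitCell (k : Fin 2 → ℤ) : MeasurableSet (unitCell k) := by
  have : unitCell k = ⋂ i, (fun x : Plane => x i) ⁻¹' Set.Ioc (k i : ℝ) (k i + 1) := by
    ext x; simp [unitCell]
  rw [this]
  exact MeasurableSet.iInter fun i => measurableSet_Ioc.preimage (by fun_prop)

/-- The cells are of type `Ioc` while `torusRep` uses `Ico`; this is harmless because g sees only
the class of a point. -/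
theorem integral_torus_eq (g : Torus → ℂ) :
    ∫ t, g t ∂torusMeasure = ∫ x in unitCell 0, g (toTorus x) := by
  have h := integral_preimage (d := Fin 2) g 0
  refine Eq.trans h ?_
  rw [← (PiLp.volume_preserving_toLp (Fin 2)).setIntegral_preimage_emb
    (MeasurableEquiv.toLp 2 (Fin 2 → ℝ)).measurableEmbedding]
  congr 2
  congr 1
  ext x
  simp [unitCell]

theorem iUnion_unitCell : ⋃ k, unitCell k = Set.univ := by
  refine Set.eq_univ_of_forall fun x => Set.mem_iUnion.2 ⟨fun i => ⌈x i⌉ - 1, fun i => ?_⟩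
  push_cast
  constructor
  · linarith [Int.ceil_lt_add_one (x i)]
  · linarith [Int.le_ceil (x i)]

theorem pairwise_disjoint_unitCell : Pairwise (Function.onFun Disjoint unitCell) := by
  intro k l hkl
  refine Set.disjoint_left.2 fun x hx hy => hkl ?_
  funext i
  have h1 := hx i
  have h2 := hy i
  have h3 : k i < l i + 1 := by exact_mod_cast h1.1.trans_le h2.2
  have h4 : l i < k i + 1 := by exact_mod_cast h2.1.trans_le h1.2
  omega

theorem setIntegral_unitCell (F : Plane → ℂ) (k : Fin 2 → ℤ) :
    ∫ x in unitCell k, F x = ∫ x in unitCell 0, F (x + intPoint k) := by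
  rw [← (measurePreserving_add_right volume (intPoint k)).setIntegral_preimage_emb
    (measurableEmbedding_addRight (intPoint k))]
  congr 2
  ext x
  have h : ∀ i, (x + intPoint k) i = x i + (k i : ℝ) := fun i => rfl
  simp only [unitCell, Set.mem_preimage, Set.mem_ofPred_eq, h, Set.mem_Ioc, Pi.zero_apply,
    Int.cast_zero, zero_add]
  refine forall_congr' fun i => ?_
  constructor <;> rintro ⟨h1, h2⟩ <;> constructor <;> linarith

/-- Unfolding: the integer cells tile the plane and the character is periodic, so the integral over
K collects in the unit cell with the lattice count as multiplicity. -/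
theorem integral_mFourier_mul_count {K : Set Plane} (hK : Bornology.IsBounded K)
    (hm : MeasurableSet K) (m : Fin 2 → ℤ) :
    ∫ x in unitCell 0, mFourier m (toTorus x) * (({k | x + intPoint k ∈ K}.ncard : ℝ) : ℂ)
      = ∫ x in K, mFourier m (toTorus x) := by
  obtain ⟨S, hS⟩ := exists_finset_lattice_subset hK
  set F : Plane → ℂ := K.indicator fun x => mFourier m (toTorus x) with hF
  have hcont : Continuous fun x => mFourier m (toTorus x) :=
    (mFourier m).continuous.comp continuous_toTorus
  have hFi : Integrable F := by
    rw [hF, integrable_indicator_iff hm]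
    refine Measure.integrableOn_of_bounded (M := 1) hK.measure_lt_top.ne
      hcont.aestronglyMeasurable (Filter.Eventually.of_forall fun x => ?_)
    rw [norm_mFourier_apply]
  have hmem : ∀ x ∈ unitCell 0, ∀ i, x i ∈ Set.Icc (0 : ℝ) 1 := by
    intro x hx i
    have := hx i
    simp only [Pi.zero_apply, Int.cast_zero, zero_add] at this
    exact ⟨this.1.le, this.2⟩
  have hsum := hasSum_integral_iUnion (f := F) (μ := volume) measurableSet_unitCell
    pairwise_disjoint_unitCell hFi.integrableOn
  rw [iUnion_unitCell, setIntegral_univ, hF, integral_indicator hm, ← hF] at hsum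
  rw [← hsum.tsum_eq, tsum_eq_sum (s := S)]
  · rw [Finset.sum_congr rfl fun k _ => setIntegral_unitCell F k]
    rw [← integral_finsetSum]
    · refine setIntegral_congr_fun (measurableSet_unitCell 0) fun x hx => ?_
      rw [ncard_eq_sum_indicator (hS x (hmem x hx))]
      push_cast
      rw [Finset.mul_sum]
      refine Finset.sum_congr rfl fun k _ => ?_
      by_cases h : x + intPoint k ∈ K <;> simp [hF, h, mFourier_toTorus_add_intPoint]
    · intro k _
      exact (hFi.comp_add_right (intPoint k)).integrableOn
  · intro k hk
    rw [setIntegral_unitCell, setIntegral_eq_zero_of_forall_eq_zero]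
    intro x hx
    rw [hF, Set.indicator_of_notMem]
    exact fun h => hk (hS x (hmem x hx) k h)

/-- The complex-valued discrepancy of a set on the torus. -/
noncomputable def complexDiscrepancy (K : Set Plane) (t : Torus) : ℂ := (torusDiscrepancy K 1 t : ℝ)

theorem torusCoeff_const (c : ℂ) {m : Fin 2 → ℤ} (hm : m ≠ 0) : torusCoeff (fun _ => c) m = 0 := by
  unfold torusCoeff
  rw [integral_mul_const]
  have h := (orthonormal_iff_ite.1 (orthonormal_mFourier (d := Fin 2))) m 0
  rw [if_neg hm, ContinuousMap.inner_toLp] at h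
  simp only [mFourier_zero, ContinuousMap.one_apply, one_mul, ← mFourier_neg] at h
  rw [show ∫ t, mFourier (-m) t ∂torusMeasure = 0 from h, zero_mul]

theorem torusCoeff_complexDiscrepancy {K : Set Plane} (hK : Bornology.IsBounded K)
    (hm : MeasurableSet K) (m : Fin 2 → ℤ) :
    torusCoeff (complexDiscrepancy K) m
      = (∫ x in K, mFourier (-m) (toTorus x)) - torusCoeff (fun _ => (volume.real K : ℂ)) m := by
  obtain ⟨B, hB⟩ := exists_bound_torusDiscrepancy_one hK
  have hi : Integrable (fun t => mFourier (-m) t * complexDiscrepancy K t) torusMeasure := by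
    refine Integrable.of_bound (C := B) ?_ (Filter.Eventually.of_forall fun t => ?_)
    · exact ((mFourier (-m)).continuous.measurable.mul
        (Complex.measurable_ofReal.comp (measurable_torusDiscrepancy_one hK hm))).aestronglyMeasurable
    · rw [norm_mul, norm_mFourier_apply, one_mul, complexDiscrepancy, Complex.norm_real]
      exact hB t
  have hj : Integrable (fun t => mFourier (-m) t * (volume.real K : ℂ)) torusMeasure :=
    Integrable.of_bound (C := ‖(volume.real K : ℂ)‖)
      ((mFourier (-m)).continuous.measurable.mul_const _).aestronglyMeasurable
      (Filter.Eventually.of_forall fun t => by rw [norm_mul, norm_mFourier_apply, one_mul])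
  rw [eq_sub_iff_add_eq, torusCoeff, torusCoeff, ← integral_add hi hj, integral_torus_eq,
    ← integral_mFourier_mul_count hK hm]
  congr 1
  funext x
  rw [← mul_add, complexDiscrepancy, torusDiscrepancy_toTorus, discrepancy_one_eq]
  push_cast
  ring

theorem torusCoeff_complexDiscrepancy_of_ne {K : Set Plane} (hK : Bornology.IsBounded K)
    (hm : MeasurableSet K) {m : Fin 2 → ℤ} (h0 : m ≠ 0) :
    torusCoeff (complexDiscrepancy K) m = ∫ x in K, mFourier (-m) (toTorus x) := by
  rw [torusCoeff_complexDiscrepancy hK hm, torusCoeff_const _ h0, sub_zero]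

theorem torusCoeff_complexDiscrepancy_zero {K : Set Plane} (hK : Bornology.IsBounded K)
    (hm : MeasurableSet K) : torusCoeff (complexDiscrepancy K) 0 = 0 := by
  rw [torusCoeff_complexDiscrepancy hK hm, torusCoeff]
  simp [mFourier_zero]

/-! ### Decay of the Fourier transform from curvature -/

/-- Second differences with half a period as step: an integrable function which is midpoint concave
at scale `h` away from the ends of its support, and at most `M` near these ends, integrates to at
most `2 M h` against an oscillation of half period `h`. -/
theorem norm_integral_mul_le_of_midpoint_concave {L : ℝ → ℝ} {e : ℝ → ℂ} {a b h M : ℝ}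
    (hh : 0 < h) (hM : 0 ≤ M) (hL : Integrable L) (h0 : ∀ s, 0 ≤ L s)
    (ha : ∀ s < a, L s = 0) (hb : ∀ s, b < s → L s = 0)
    (hconc : ∀ s, a + h ≤ s → s ≤ b - h → L (s - h) + L (s + h) ≤ 2 * L s)
    (hMa : ∀ s ≤ a + 2 * h, L s ≤ M) (hMb : ∀ s, b - 2 * h ≤ s → L s ≤ M)
    (he : Continuous e) (he1 : ∀ s, ‖e s‖ = 1) (heh : ∀ s, e (s + h) = -e s) :
    ‖∫ s, L s * e s‖ ≤ 2 * M * h := by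
  set g : ℝ → ℝ := fun s => 2 * L s - L (s - h) - L (s + h) with hg
  have hLm : Integrable fun s => L (s - h) := hL.comp_sub_right h
  have hLp : Integrable fun s => L (s + h) := hL.comp_add_right h
  have hgi : Integrable g := ((hL.const_mul 2).sub hLm).sub hLp
  have hg0 : ∫ s, g s = 0 := by
    have h1 := integral_sub_right_eq_self (μ := volume) L h
    have h2 := integral_add_right_eq_self (μ := volume) L h
    have hi : Integrable fun s => 2 * L s - L (s - h) := (hL.const_mul 2).sub hLm
    simp only [hg]
    rw [integral_sub hi hLp, integral_sub (hL.const_mul 2) hLm,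
      integral_const_mul, h1, h2]
    ring
  have hmul : ∀ {f : ℝ → ℝ}, Integrable f → Integrable fun s => (f s : ℂ) * e s := by
    intro f hf
    refine hf.ofReal.mul_bdd (c := 1) he.aestronglyMeasurable
      (Filter.Eventually.of_forall fun s => (he1 s).le)
  have hem : ∀ s, e (s - h) = -e s := by
    intro s
    have := heh (s - h)
    rw [sub_add_cancel] at this
    rw [this, neg_neg]
  have h4 : ∫ s, (g s : ℂ) * e s = 4 * ∫ s, (L s : ℂ) * e s := by
    have h1 : ∫ s, (L (s - h) : ℂ) * e s = -∫ s, (L s : ℂ) * e s := by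
      rw [← integral_sub_right_eq_self (μ := volume) (fun s => (L s : ℂ) * e s) h, ← integral_neg]
      congr 1
      funext s
      rw [hem]
      ring
    have h2 : ∫ s, (L (s + h) : ℂ) * e s = -∫ s, (L s : ℂ) * e s := by
      rw [← integral_add_right_eq_self (μ := volume) (fun s => (L s : ℂ) * e s) h, ← integral_neg]
      congr 1
      funext s
      rw [heh]
      ring
    have h3 : ∀ s, (g s : ℂ) * e s
        = 2 * ((L s : ℂ) * e s) - (L (s - h) : ℂ) * e s - (L (s + h) : ℂ) * e s := by
      intro s
      rw [hg]
      push_cast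
      ring
    have hi : Integrable fun s => 2 * ((L s : ℂ) * e s) - (L (s - h) : ℂ) * e s :=
      ((hmul hL).const_mul 2).sub (hmul hLm)
    simp_rw [h3]
    rw [integral_sub hi (hmul hLp),
      integral_sub ((hmul hL).const_mul 2) (hmul hLm), integral_const_mul, h1, h2]
    ring
  set E₁ := Set.Icc (a - h) (a + h)
  set E₂ := Set.Icc (b - h) (b + h)
  have hEi : ∀ c : ℝ, Integrable ((Set.Icc (c - h) (c + h)).indicator fun _ => 2 * M) := fun c =>
    (integrable_indicator_iff measurableSet_Icc).2 (integrableOn_const (by simp))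
  have hEint : ∀ c : ℝ, ∫ s, (Set.Icc (c - h) (c + h)).indicator (fun _ => 2 * M) s
      = 4 * M * h := by
    intro c
    rw [integral_indicator_const _ measurableSet_Icc, Real.volume_real_Icc_of_le (by linarith),
      smul_eq_mul]
    ring
  -- Near an end one outer value vanishes and the other is at most M, so g ≥ -M and |g| ≤ g + 2M.
  -- Integration gives 0 plus 4Mh for each end.
  have hle : ∀ s, |g s| ≤ g s + E₁.indicator (fun _ => 2 * M) s + E₂.indicator (fun _ => 2 * M) s := by
    intro s
    have hn1 : 0 ≤ E₁.indicator (fun _ => 2 * M) s :=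
      Set.indicator_nonneg (fun _ _ => by positivity) s
    have hn2 : 0 ≤ E₂.indicator (fun _ => 2 * M) s :=
      Set.indicator_nonneg (fun _ _ => by positivity) s
    by_cases h1 : s ∈ E₁
    · rw [Set.indicator_of_mem h1]
      -- At s = a + h the value L a need not be 0. Concavity applies instead, or, if the support is
      -- too short for it, the vanishing beyond b.
      rcases eq_or_lt_of_le h1.2 with heq | hlt
      · by_cases hc : s ≤ b - h
        · have := hconc s heq.ge hc
          rw [abs_of_nonneg (by rw [hg]; linarith)]
          linarith
        · have h5 : L (s + h) = 0 := hb _ (by linarith)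
          have h6 := hMa (s - h) (by linarith)
          rw [abs_le]
          simp only [hg]
          constructor <;> linarith [h0 s, h0 (s - h)]
      · have h5 : L (s - h) = 0 := ha _ (by linarith)
        have h6 := hMa (s + h) (by linarith [h1.2])
        rw [abs_le]
        simp only [hg]
        constructor <;> linarith [h0 s, h0 (s + h)]
    · by_cases h2 : s ∈ E₂
      · rw [Set.indicator_of_mem h2]
        rcases eq_or_lt_of_le h2.1 with heq | hlt
        · by_cases hc : a + h ≤ s
          · have := hconc s hc heq.ge
            rw [abs_of_nonneg (by rw [hg]; linarith)]
            linarith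
          · have h5 : L (s - h) = 0 := ha _ (by linarith)
            have h6 := hMb (s + h) (by linarith)
            rw [abs_le]
            simp only [hg]
            constructor <;> linarith [h0 s, h0 (s + h)]
        · have h5 : L (s + h) = 0 := hb _ (by linarith)
          have h6 := hMb (s - h) (by linarith [h2.1])
          rw [abs_le]
          simp only [hg]
          constructor <;> linarith [h0 s, h0 (s - h)]
      · have hg' : 0 ≤ g s := by
          simp only [hg]
          by_cases h3 : s < a - h
          · rw [ha (s - h) (by linarith), ha (s + h) (by linarith)]
            linarith [h0 s]
          by_cases h4 : b + h < s
          · rw [hb (s - h) (by linarith), hb (s + h) (by linarith)]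
            linarith [h0 s]
          have h5 : a + h < s := by
            by_contra hc
            exact h1 ⟨by linarith, by linarith⟩
          have h6 : s < b - h := by
            by_contra hc
            exact h2 ⟨by linarith, by linarith⟩
          linarith [hconc s h5.le h6.le]
        rw [abs_of_nonneg hg']
        linarith
  have hgE : Integrable fun s => g s + E₁.indicator (fun _ => 2 * M) s := hgi.add (hEi a)
  have hfin : ‖∫ s, (g s : ℂ) * e s‖ ≤ 8 * M * h := by
    calc ‖∫ s, (g s : ℂ) * e s‖ ≤ ∫ s, ‖(g s : ℂ) * e s‖ := norm_integral_le_integral_norm _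
      _ = ∫ s, |g s| := by simp_rw [norm_mul, he1, mul_one, Complex.norm_real, Real.norm_eq_abs]
      _ ≤ ∫ s, (g s + E₁.indicator (fun _ => 2 * M) s + E₂.indicator (fun _ => 2 * M) s) :=
          integral_mono hgi.abs (hgE.add (hEi b)) hle
      _ = 8 * M * h := by
          rw [integral_add hgE (hEi b), integral_add hgi (hEi a), hg0, hEint, hEint]
          ring
  rw [h4, norm_mul] at hfin
  norm_num at hfin
  linarith

/-- In every direction `e` the set `K` has a point `z` such that `K` is contained in the disc of
radius `ρ` which touches the supporting line of `K` at `z`. -/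
def HasCapRadius (K : Set Plane) (ρ : ℝ) : Prop :=
  ∀ e : Plane, ‖e‖ = 1 → ∃ z ∈ K, ∀ y ∈ K, ‖y - z‖ ^ 2 ≤ 2 * ρ * inner ℝ e (z - y)

/-- The point with given coordinates in an orthonormal frame. -/
noncomputable def framePoint (b : OrthonormalBasis (Fin 2) ℝ Plane) (p : ℝ × ℝ) : Plane :=
  b.repr.symm (WithLp.toLp 2 ![p.1, p.2])

theorem framePoint_eq (b : OrthonormalBasis (Fin 2) ℝ Plane) (p : ℝ × ℝ) :
    framePoint b p = p.1 • b 0 + p.2 • b 1 := by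
  unfold framePoint
  rw [← OrthonormalBasis.sum_repr_symm, Fin.sum_univ_two]
  simp

theorem framePoint_sub (b : OrthonormalBasis (Fin 2) ℝ Plane) (p q : ℝ × ℝ) :
    framePoint b p - framePoint b q = framePoint b (p - q) := by
  simp only [framePoint_eq, Prod.fst_sub, Prod.snd_sub]
  module

theorem norm_framePoint_sq (b : OrthonormalBasis (Fin 2) ℝ Plane) (p : ℝ × ℝ) :
    ‖framePoint b p‖ ^ 2 = p.1 ^ 2 + p.2 ^ 2 := by
  unfold framePoint
  rw [LinearIsometryEquiv.norm_map, EuclideanSpace.norm_sq_eq, Fin.sum_univ_two]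
  simp

theorem inner_framePoint (b : OrthonormalBasis (Fin 2) ℝ Plane) (p : ℝ × ℝ) :
    inner ℝ (b 0) (framePoint b p) = p.1 := by
  rw [framePoint, ← b.repr_apply_apply]
  simp

theorem framePoint_surjective (b : OrthonormalBasis (Fin 2) ℝ Plane) (x : Plane) :
    ∃ p, framePoint b p = x := by
  refine ⟨(b.repr x 0, b.repr x 1), ?_⟩
  rw [framePoint, LinearIsometryEquiv.symm_apply_eq]
  ext i
  fin_cases i <;> simp

theorem measurePreserving_framePoint (b : OrthonormalBasis (Fin 2) ℝ Plane) :
    MeasurePreserving (framePoint b) :=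
  b.measurePreserving_repr_symm.comp ((PiLp.volume_preserving_toLp (Fin 2)).comp
    (volume_preserving_finTwoArrow ℝ).symm)

theorem measurableEmbedding_framePoint (b : OrthonormalBasis (Fin 2) ℝ Plane) :
    MeasurableEmbedding (framePoint b) :=
  (b.repr.symm.toHomeomorph.measurableEmbedding).comp
    ((MeasurableEquiv.toLp 2 (Fin 2 → ℝ)).measurableEmbedding.comp
      (MeasurableEquiv.finTwoArrow (α := ℝ)).symm.measurableEmbedding)

theorem continuous_framePoint (b : OrthonormalBasis (Fin 2) ℝ Plane) :
    Continuous (framePoint b) := by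
  simp_rw [funext (framePoint_eq b)]
  fun_prop

theorem exists_orthonormalBasis_zero_eq {e : Plane} (he : ‖e‖ = 1) :
    ∃ b : OrthonormalBasis (Fin 2) ℝ Plane, b 0 = e := by
  have hv : Orthonormal ℝ (Set.domRestrict {(0 : Fin 2)} fun _ => e) := by
    refine ⟨fun _ => he, fun i j hij => (hij (Subsingleton.elim _ _)).elim⟩
  obtain ⟨b, hb⟩ := hv.exists_orthonormalBasis_extension_of_card_eq (by simp)
  exact ⟨b, hb 0 rfl⟩

theorem eq_Icc_of_convex_compact {A : Set ℝ} (hA : Convex ℝ A) (hc : IsCompact A)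
    (hne : A.Nonempty) : ∃ α β, α ≤ β ∧ A = Set.Icc α β := by
  have h := eq_Icc_of_connected_compact ⟨hne, hA.isPreconnected⟩ hc
  refine ⟨_, _, ?_, h⟩
  rw [h] at hne
  exact Set.nonempty_Icc.1 hne

/-- The Fourier transform of a convex body of cap radius `ρ` decays like `√ρ |m| ^ (-3/2)`. -/
theorem norm_setIntegral_mFourier_le {K : Set Plane} (hK : Convex ℝ K) (hc : IsCompact K) {ρ : ℝ}
    (hρ : 0 < ρ) (hcap : HasCapRadius K ρ) {m : Fin 2 → ℤ} (hm : m ≠ 0) :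
    ‖∫ x in K, mFourier (-m) (toTorus x)‖ ≤ 8 * √ρ * decayWeight (supSize m) := by
  set l : ℝ := ‖intPoint m‖ with hl
  have hsize : (supSize m : ℝ) ≤ l := by
    have h : ∀ i, ((m i).natAbs : ℝ) ≤ l := by
      intro i
      have := PiLp.norm_apply_le (intPoint m) i
      rw [Nat.cast_natAbs, Int.cast_abs]
      exact this
    rcases max_choice (m 0).natAbs (m 1).natAbs with h' | h'
    · rw [supSize, h']; exact h 0
    · rw [supSize, h']; exact h 1
  have hs0 : 0 < supSize m := Nat.pos_of_ne_zero (mt supSize_eq_zero.1 hm)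
  have hs1 : (0 : ℝ) < supSize m := by exact_mod_cast hs0
  have hl0 : 0 < l := hs1.trans_le hsize
  -- In a frame with first axis along m the character depends on the first coordinate only, and
  -- Fubini reduces the integral to chord lengths.
  obtain ⟨b, hb⟩ := exists_orthonormalBasis_zero_eq (e := l⁻¹ • intPoint m) (by
    rw [norm_smul, norm_inv, Real.norm_of_nonneg hl0.le, ← hl, inv_mul_cancel₀ hl0.ne'])
  set e : ℝ → ℂ := fun s => Complex.exp (((-(2 * Real.pi * l * s) : ℝ) : ℂ) * Complex.I) with he
  have hexp : ∀ p, mFourier (-m) (toTorus (framePoint b p)) = e p.1 := by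
    intro p
    have h1 : inner ℝ (intPoint m) (framePoint b p) = l * p.1 := by
      rw [← inner_framePoint b p, hb, real_inner_smul_left, mul_inv_cancel_left₀ hl0.ne']
    have h2 : inner ℝ (intPoint m) (framePoint b p)
        = m 0 * framePoint b p 0 + m 1 * framePoint b p 1 := by
      rw [PiLp.inner_apply, Fin.sum_univ_two]
      simp [intPoint, mul_comm]
    rw [h2] at h1
    simp only [mFourier, ContinuousMap.coe_mk, toTorus, Fin.prod_univ_two, fourier_coe_apply, he]
    rw [← Complex.exp_add]
    congr 1
    have h3 : (m 0 * framePoint b p 0 + m 1 * framePoint b p 1 : ℂ) = l * p.1 := by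
      exact_mod_cast congrArg (fun r : ℝ => (r : ℂ)) h1
    simp only [Pi.neg_apply, Int.cast_neg, Complex.ofReal_one, div_one]
    push_cast
    linear_combination (-(2 * Real.pi * Complex.I)) * h3
  set K' : Set (ℝ × ℝ) := framePoint b ⁻¹' K with hK'
  have hmK : MeasurableSet K' := (continuous_framePoint b).measurable hc.measurableSet
  have hvol : volume K' = volume K :=
    (measurePreserving_framePoint b).measure_preimage hc.measurableSet.nullMeasurableSet
  set A : ℝ → Set ℝ := fun s => {t | framePoint b (s, t) ∈ K} with hA
  set L : ℝ → ℝ := fun s => volume.real (A s) with hL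
  have hfin : volume K' ≠ ⊤ := hvol ▸ hc.measure_lt_top.ne
  have hind : Integrable (K'.indicator fun _ => (1 : ℝ)) (volume.prod volume) :=
    (integrable_indicator_iff hmK).2 (integrableOn_const hfin)
  have hLeq : ∀ s, ∫ t, K'.indicator (fun _ => (1 : ℝ)) (s, t) = L s := by
    intro s
    have hAm : MeasurableSet (A s) := measurable_prodMk_left hmK
    have : ∀ t, K'.indicator (fun _ => (1 : ℝ)) (s, t) = (A s).indicator (fun _ => 1) t :=
      fun t => rfl
    simp_rw [this]
    rw [integral_indicator_const _ hAm, smul_eq_mul, mul_one]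
  have hLi : Integrable L := by
    have := hind.integral_prod_left
    simp_rw [hLeq] at this
    exact this
  have hint : ∫ x in K, mFourier (-m) (toTorus x) = ∫ s, (L s : ℂ) * e s := by
    rw [← (measurePreserving_framePoint b).setIntegral_preimage_emb
      (measurableEmbedding_framePoint b)]
    simp_rw [hexp]
    rw [← hK', ← integral_indicator hmK]
    have hecont : Continuous e := by rw [he]; fun_prop
    have hi2 : Integrable (K'.indicator fun p : ℝ × ℝ => e p.1) (volume.prod volume) := by
      rw [integrable_indicator_iff hmK]
      refine Measure.integrableOn_of_bounded (M := 1) hfin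
        (hecont.comp continuous_fst).aestronglyMeasurable (Filter.Eventually.of_forall fun p => ?_)
      rw [he, Complex.norm_exp_ofReal_mul_I]
    refine (integral_prod _ hi2).trans ?_
    congr 1
    funext s
    rw [← hLeq, ← integral_complex_ofReal, ← integral_mul_const]
    congr 1
    funext t
    by_cases h : (s, t) ∈ K' <;> simp [h]
  have hAcomp : ∀ s, IsCompact (A s) := by
    intro s
    obtain ⟨B, hB⟩ := hc.isBounded.subset_closedBall 0
    refine (isCompact_Icc (a := -B) (b := B)).of_isClosed_subset ?_ fun t ht => ?_
    · exact hc.isClosed.preimage ((continuous_framePoint b).comp (Continuous.prodMk_right s))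
    · have h1 := hB ht
      rw [mem_closedBall_zero_iff] at h1
      have h2 := norm_framePoint_sq b (s, t)
      have h3 : 0 ≤ B := (norm_nonneg _).trans h1
      have h4 : t ^ 2 ≤ B ^ 2 := by
        have := pow_le_pow_left₀ (norm_nonneg _) h1 2
        simp only at h2
        nlinarith [sq_nonneg s]
      exact abs_le.1 (abs_le_of_sq_le_sq h4 h3)
  have hcomb : ∀ {s t s' t' θ θ' : ℝ}, t ∈ A s → t' ∈ A s' → 0 ≤ θ → 0 ≤ θ' → θ + θ' = 1 →
      θ * t + θ' * t' ∈ A (θ * s + θ' * s') := by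
    intro s t s' t' θ θ' h h' hθ hθ' h1
    have := hK h h' hθ hθ' h1
    simp only [hA, Set.mem_ofPred_eq]
    convert this using 1
    simp only [framePoint_eq]
    module
  have hAconv : ∀ s, Convex ℝ (A s) := by
    intro s t ht t' ht' θ θ' hθ hθ' h1
    have := hcomb ht ht' hθ hθ' h1
    rwa [← add_mul, h1, one_mul] at this
  obtain ⟨z, hz, hcapz⟩ := hcap (b 0) (b.orthonormal.1 0)
  obtain ⟨w, hw, hcapw⟩ := hcap (-b 0) (by rw [norm_neg]; exact b.orthonormal.1 0)
  obtain ⟨⟨zs, zt⟩, rfl⟩ := framePoint_surjective b z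
  obtain ⟨⟨ws, wt⟩, rfl⟩ := framePoint_surjective b w
  have htop : ∀ {s t}, t ∈ A s → (s - zs) ^ 2 + (t - zt) ^ 2 ≤ 2 * ρ * (zs - s) := by
    intro s t ht
    have := hcapz _ ht
    rwa [framePoint_sub, framePoint_sub, norm_framePoint_sq, inner_framePoint] at this
  have hbot : ∀ {s t}, t ∈ A s → (s - ws) ^ 2 + (t - wt) ^ 2 ≤ 2 * ρ * (s - ws) := by
    intro s t ht
    have := hcapw _ ht
    rw [framePoint_sub, framePoint_sub, norm_framePoint_sq, inner_neg_left, inner_framePoint] at this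
    simp only [Prod.mk_sub_mk, neg_sub] at this
    exact this
  have hempty : ∀ {s}, A s = ∅ → L s = 0 := by
    intro s h
    simp only [hL, h, measureReal_empty]
  have hnonempty : ∀ {s}, ws ≤ s → s ≤ zs → (A s).Nonempty := by
    intro s h1 h2
    rcases eq_or_lt_of_le (h1.trans h2) with heq | hlt
    · have : s = zs := le_antisymm h2 (heq ▸ h1)
      exact ⟨zt, this ▸ hz⟩
    · have hd : 0 < zs - ws := by linarith
      have := hcomb (s := ws) (s' := zs) hw hz (div_nonneg (sub_nonneg.2 h2) hd.le)
        (div_nonneg (sub_nonneg.2 h1) hd.le) (by field_simp; ring)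
      have h3 : (zs - s) / (zs - ws) * ws + (s - ws) / (zs - ws) * zs = s := by
        field_simp; ring
      rw [h3] at this
      exact ⟨_, this⟩
  have hIcc : ∀ {α β : ℝ}, α ≤ β → volume.real (Set.Icc α β) = β - α := fun h =>
    Real.volume_real_Icc_of_le h
  have hLle : ∀ {s c q : ℝ}, 0 ≤ q → (∀ t ∈ A s, (t - c) ^ 2 ≤ q) → L s ≤ 2 * √q := by
    intro s c q hq h
    have hsub : A s ⊆ Set.Icc (c - √q) (c + √q) := by
      intro t ht
      have := Real.abs_le_sqrt (h t ht)
      rw [abs_le] at this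
      exact ⟨by linarith, by linarith⟩
    have h1 := measureReal_mono (μ := volume) hsub (by simp)
    rw [hIcc (by linarith [Real.sqrt_nonneg q])] at h1
    simp only [hL]
    linarith
  -- Half a period of e.
  set h : ℝ := 1 / (2 * l) with hh
  have hh0 : 0 < h := by positivity
  -- At depth at most 2h the cap inequality confines a chord to half-length √(2ρ · 2h), hence M.
  -- Then 2Mh = 8 √ρ h√h, and h ≤ 1 / |m|.
  have hmain := norm_integral_mul_le_of_midpoint_concave (L := L) (e := e) (a := ws) (b := zs)
    (h := h) (M := 2 * √(4 * ρ * h)) hh0 (by positivity) hLi (fun s => measureReal_nonneg)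
    (fun s hs => hempty (Set.eq_empty_of_forall_notMem fun t ht => by
      nlinarith [hbot ht, sq_nonneg (s - ws), sq_nonneg (t - wt)]))
    (fun s hs => hempty (Set.eq_empty_of_forall_notMem fun t ht => by
      nlinarith [htop ht, sq_nonneg (s - zs), sq_nonneg (t - zt)]))
    (by
      intro s h1 h2
      obtain ⟨α, β, hαβ, hS⟩ := eq_Icc_of_convex_compact (hAconv (s - h)) (hAcomp _)
        (hnonempty (by linarith) (by linarith))
      obtain ⟨α', β', hαβ', hS'⟩ := eq_Icc_of_convex_compact (hAconv (s + h)) (hAcomp _)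
        (hnonempty (by linarith) (by linarith))
      -- Midpoints of the endpoints of two chords lie in K, so the middle chord is at least as long
      -- as the average.
      have hmid : ∀ {t t'}, t ∈ A (s - h) → t' ∈ A (s + h) → (t + t') / 2 ∈ A s := by
        intro t t' ht ht'
        have := hcomb (θ := 1 / 2) (θ' := 1 / 2) ht ht' (by norm_num) (by norm_num) (by norm_num)
        have h3 : (1 / 2 : ℝ) * (s - h) + 1 / 2 * (s + h) = s := by ring
        rw [h3] at this
        convert this using 1
        ring
      have hl1 : (α + α') / 2 ∈ A s := hmid (hS ▸ Set.left_mem_Icc.2 hαβ)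
        (hS' ▸ Set.left_mem_Icc.2 hαβ')
      have hr1 : (β + β') / 2 ∈ A s := hmid (hS ▸ Set.right_mem_Icc.2 hαβ)
        (hS' ▸ Set.right_mem_Icc.2 hαβ')
      have hsub : Set.Icc ((α + α') / 2) ((β + β') / 2) ⊆ A s :=
        (hAconv s).ordConnected.out hl1 hr1
      have h3 := measureReal_mono (μ := volume) hsub (hAcomp s).measure_lt_top.ne
      rw [hIcc (by linarith)] at h3
      simp only [hL]
      rw [hS, hS', hIcc hαβ, hIcc hαβ']
      linarith)
    (fun s hs => hLle (c := wt) (by positivity) fun t ht => by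
      nlinarith [hbot ht, sq_nonneg (s - ws)])
    (fun s hs => hLle (c := zt) (by positivity) fun t ht => by
      nlinarith [htop ht, sq_nonneg (s - zs)])
    (by rw [he]; fun_prop)
    (fun s => by rw [he, Complex.norm_exp_ofReal_mul_I])
    (fun s => by
      simp only [he]
      rw [← mul_neg_one (Complex.exp _), ← Complex.exp_neg_pi_mul_I, ← Complex.exp_add]
      congr 1
      have h1 : 2 * Real.pi * l * (s + h) = 2 * Real.pi * l * s + Real.pi := by
        rw [hh]; field_simp
      rw [h1]
      push_cast
      ring)
  rw [hint]
  refine hmain.trans ?_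
  have h1 : √(4 * ρ * h) = 2 * √ρ * √h := by
    rw [Real.sqrt_mul (by positivity), Real.sqrt_mul (by norm_num)]
    norm_num
  have h2 : h * √h ≤ decayWeight (supSize m) := by
    have h3 : h ≤ 1 / supSize m := by
      rw [hh]
      exact one_div_le_one_div_of_le hs1 (by linarith)
    unfold decayWeight
    rw [← one_div_mul_one_div, ← Real.sqrt_one, ← Real.sqrt_div (by norm_num), Real.sqrt_one]
    exact mul_le_mul h3 (Real.sqrt_le_sqrt h3) (Real.sqrt_nonneg _) (by positivity)
  rw [h1]
  nlinarith [mul_le_mul_of_nonneg_left h2 (Real.sqrt_nonneg ρ)]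

/-! ### Cap radius under similarities and from rolling -/

theorem HasCapRadius.smul {K : Set Plane} {ρ : ℝ} (h : HasCapRadius K ρ) {a : ℝ} (ha : 0 < a) :
    HasCapRadius (a • K) (a * ρ) := by
  intro e he
  obtain ⟨z, hz, hcap⟩ := h e he
  refine ⟨a • z, Set.smul_mem_smul_set hz, ?_⟩
  rintro _ ⟨y, hy, rfl⟩
  have := mul_le_mul_of_nonneg_left (hcap y hy) (sq_nonneg a)
  simp only
  rw [← smul_sub, ← smul_sub, norm_smul, mul_pow, real_inner_smul_right, Real.norm_of_nonneg ha.le]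
  linarith

theorem HasCapRadius.vadd {K : Set Plane} {ρ : ℝ} (h : HasCapRadius K ρ) (v : Plane) :
    HasCapRadius (v +ᵥ K) ρ := by
  intro e he
  obtain ⟨z, hz, hcap⟩ := h e he
  refine ⟨v +ᵥ z, Set.vadd_mem_vadd_set hz, ?_⟩
  rintro _ ⟨y, hy, rfl⟩
  simp only [vadd_eq_add, add_sub_add_left_eq_sub]
  exact hcap y hy

theorem closure_vadd_set (v : Plane) (s : Set Plane) : closure (v +ᵥ s) = v +ᵥ closure s :=
  ((Homeomorph.addLeft v).image_closure s).symm

/-- A set which rolls unimpeded inside a disc of radius `r` has cap radius `r`. -/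
theorem RollsUnimpededInside.hasCapRadius {Ω : Set Plane} {c : Plane} {r : ℝ} (hr : 0 < r)
    (h : RollsUnimpededInside Ω (Metric.closedBall c r)) : HasCapRadius (closure Ω) r := by
  intro e he
  -- The contact point with outer normal e. After translation, containment in the disc reads ‖(y -
  -- z) + r e‖ ≤ r, and expanding the square is the cap inequality.
  obtain ⟨v, hv, hx⟩ := h (c + r • e) (by
    rw [frontier_closedBall _ hr.ne', mem_sphere_iff_norm, add_sub_cancel_left, norm_smul, he,
      Real.norm_of_nonneg hr.le, mul_one])
  rw [closure_vadd_set] at hx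
  obtain ⟨z, hz, hzx⟩ := hx
  refine ⟨z, hz, fun y hy => ?_⟩
  have hsub : v +ᵥ closure Ω ⊆ Metric.closedBall c r := by
    rw [← closure_vadd_set]
    exact closure_minimal hv Metric.isClosed_closedBall
  have h1 := hsub (Set.vadd_mem_vadd_set hy)
  simp only [vadd_eq_add] at hzx
  rw [mem_closedBall_iff_norm, vadd_eq_add] at h1
  have h2 : v + y - c = (y - z) + r • e := by
    have : v = c + r • e - z := by rw [← hzx]; abel
    rw [this]; abel
  rw [h2] at h1
  have h3 := pow_le_pow_left₀ (norm_nonneg _) h1 2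
  rw [norm_add_sq_real, norm_smul, he, Real.norm_of_nonneg hr.le, real_inner_smul_right,
    real_inner_comm] at h3
  have h4 : inner ℝ e (z - y) = -inner ℝ e (y - z) := by rw [← inner_neg_right, neg_sub]
  rw [h4]
  linarith

theorem RollsUnimpededInside.isBounded {Ω : Set Plane} {c : Plane} {r : ℝ} (hr : 0 < r)
    (h : RollsUnimpededInside Ω (Metric.closedBall c r)) : Bornology.IsBounded Ω := by
  obtain ⟨v, hv, -⟩ := h (c + r • EuclideanSpace.single 0 1) (by
    rw [frontier_closedBall _ hr.ne', mem_sphere_iff_norm, add_sub_cancel_left, norm_smul,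
      Real.norm_of_nonneg hr.le]
    simp)
  have := (Metric.isBounded_closedBall.subset hv).vadd (-v)
  rwa [neg_vadd_vadd] at this

/-- The fourth moment of the discrepancy of a convex body of cap radius `ρ`, averaged over a square
of side `2 ε`. -/
theorem lintegral_torusAverage_le {K : Set Plane} (hK : Convex ℝ K) (hc : IsCompact K) {ρ : ℝ}
    (hρ : 0 < ρ) (hcap : HasCapRadius K ρ) {ε : ℝ} (hε : 0 < ε) {N : ℕ} (hN : 1 / ε ≤ N) :
    ∫⁻ t, ‖torusAverage (boxUniform ε) (complexDiscrepancy K) t‖ₑ ^ 4 ∂torusMeasure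
      ≤ ENNReal.ofReal (4096 * ρ ^ 2 * (24 ^ 2 + 8 * (384 ^ 2 * (2 + Real.log N)))) := by
  have := boxUniform_isProbabilityMeasure hε
  have hN0 : 0 < N := by
    have : (0 : ℝ) < N := lt_of_lt_of_le (by positivity) hN
    exact_mod_cast this
  obtain ⟨B, hB⟩ := exists_bound_torusDiscrepancy_one hc.isBounded
  have hB' : ∀ t, ‖complexDiscrepancy K t‖ ≤ B := fun t => by
    rw [complexDiscrepancy, Complex.norm_real]; exact hB t
  have hm : Measurable (complexDiscrepancy K) := Complex.measurable_ofReal.comp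
    (measurable_torusDiscrepancy_one hc.isBounded hc.measurableSet)
  set q : ℝ := 8 * √ρ with hq
  have hq0 : 0 ≤ q := by positivity
  have hcoeff : ∀ m, ‖torusCoeff (torusAverage (boxUniform ε) (complexDiscrepancy K)) m‖ₑ
      ≤ ENNReal.ofReal q * ENNReal.ofReal (coeffBound N (supSize m)) := by
    intro m
    rw [← ENNReal.ofReal_mul hq0, ← ofReal_norm]
    apply ENNReal.ofReal_le_ofReal
    rw [torusCoeff_torusAverage hm hB', norm_mul]
    by_cases h0 : m = 0
    · rw [h0, torusCoeff_complexDiscrepancy_zero hc.isBounded hc.measurableSet, norm_zero, zero_mul]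
      exact mul_nonneg hq0 (coeffBound_nonneg _ _)
    · rw [torusCoeff_complexDiscrepancy_of_ne hc.isBounded hc.measurableSet h0, coeffBound,
        ← mul_assoc]
      exact mul_le_mul (norm_setIntegral_mFourier_le hK hc hρ hcap h0)
        (norm_integral_mFourier_boxUniform_le hε hN h0) (norm_nonneg _)
        (mul_nonneg hq0 (decayWeight_nonneg _))
  refine (lintegral_enorm_pow_four_le (stronglyMeasurable_torusAverage hm).aestronglyMeasurable
    (norm_torusAverage_le hB') hcoeff).trans ?_
  have h1 : ∀ k : Fin 2 → ℤ, (∑' m, ENNReal.ofReal q * ENNReal.ofReal (coeffBound N (supSize (k - m)))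
      * (ENNReal.ofReal q * ENNReal.ofReal (coeffBound N (supSize m)))) ^ 2
      = ENNReal.ofReal q ^ 4 * (∑' m, ENNReal.ofReal (coeffBound N (supSize (k - m))) *
        ENNReal.ofReal (coeffBound N (supSize m))) ^ 2 := by
    intro k
    rw [show ENNReal.ofReal q ^ 4 = (ENNReal.ofReal q ^ 2) ^ 2 by ring, ← mul_pow,
      ← ENNReal.tsum_mul_left]
    congr 2
    funext m
    ring
  simp_rw [h1]
  rw [ENNReal.tsum_mul_left]
  -- Here 4096 = 8⁴, from the constant in the Fourier decay.
  have h2 : ENNReal.ofReal q ^ 4 = ENNReal.ofReal (4096 * ρ ^ 2) := by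
    rw [← ENNReal.ofReal_pow hq0, hq, mul_pow]
    congr 1
    rw [show √ρ ^ 4 = (√ρ ^ 2) ^ 2 by ring, Real.sq_sqrt hρ.le]
    norm_num
  rw [h2, ENNReal.ofReal_mul (p := 4096 * ρ ^ 2) (by positivity)]
  exact mul_le_mul' le_rfl (tsum_sq_tsum_coeffBound_le hN0)

/-! ### Null sets and measurability -/

/-- The lattice count of a bounded measurable null set is nonnegative with mean equal to the area,
0, so it vanishes almost everywhere. -/
theorem ae_forall_notMem {Z : Set Plane} (hZ : Bornology.IsBounded Z) (h0 : volume Z = 0) :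
    ∀ᵐ t ∂torusMeasure, ∀ k, torusRep t + intPoint k ∉ Z := by
  obtain ⟨M, hM⟩ := hZ.subset_closedBall 0
  -- The measurable hull may be unbounded, hence the intersection with a ball.
  set Y : Set Plane := toMeasurable volume Z ∩ Metric.closedBall 0 M with hY
  have hYb : Bornology.IsBounded Y := Metric.isBounded_closedBall.subset Set.inter_subset_right
  have hYm : MeasurableSet Y := (measurableSet_toMeasurable _ _).inter measurableSet_closedBall
  have hY0 : volume Y = 0 :=
    measure_mono_null Set.inter_subset_left ((measure_toMeasurable Z).trans h0)
  have hZY : Z ⊆ Y := Set.subset_inter (subset_toMeasurable _ _) hM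
  have hcount : ∀ t, torusDiscrepancy Y 1 t = ({k | torusRep t + intPoint k ∈ Y}.ncard : ℝ) := by
    intro t
    rw [torusDiscrepancy, discrepancy_one_eq, measureReal_def, hY0, ENNReal.toReal_zero, sub_zero]
  have hint : ∫ t, torusDiscrepancy Y 1 t ∂torusMeasure = 0 := by
    have := torusCoeff_complexDiscrepancy_zero hYb hYm
    simp only [torusCoeff, neg_zero, mFourier_zero, ContinuousMap.one_apply, one_mul,
      complexDiscrepancy] at this
    rw [integral_complex_ofReal] at this
    exact_mod_cast this
  obtain ⟨B, hB⟩ := exists_bound_torusDiscrepancy_one hYb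
  have hi : Integrable (torusDiscrepancy Y 1) torusMeasure :=
    Integrable.of_bound (C := B) (measurable_torusDiscrepancy_one hYb hYm).aestronglyMeasurable
      (Filter.Eventually.of_forall hB)
  have hae := (integral_eq_zero_iff_of_nonneg (fun t => by rw [hcount]; positivity) hi).1 hint
  filter_upwards [hae] with t ht k hk
  rw [hcount, Pi.zero_apply, Nat.cast_eq_zero, Set.ncard_eq_zero (finite_lattice hYb _)] at ht
  exact Set.eq_empty_iff_forall_notMem.1 ht k (hZY hk)

theorem volume_smul_set_eq_zero {s : Set Plane} (h : volume s = 0) (R : ℝ) : volume (R • s) = 0 := by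
  rw [Measure.addHaar_smul, h, mul_zero]

theorem torusDiscrepancy_ae_eq_zero {Ω : Set Plane} (hb : Bornology.IsBounded Ω)
    (h0 : volume Ω = 0) (R : ℝ) : torusDiscrepancy Ω R =ᵐ[torusMeasure] 0 := by
  filter_upwards [ae_forall_notMem (hb.smul₀ R) (volume_smul_set_eq_zero h0 R)] with t ht
  have h : {k | torusRep t + intPoint k ∈ R • Ω} = ∅ := Set.eq_empty_of_forall_notMem ht
  rw [torusDiscrepancy, discrepancy_eq, measureReal_def, h0, h]
  simp

/-- A convex set may contain a non-Borel part of its boundary. The frontier is null, so almost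
everywhere the count agrees with that of the closure. -/
theorem aestronglyMeasurable_torusDiscrepancy {Ω : Set Plane} (hΩ : Convex ℝ Ω)
    (hb : Bornology.IsBounded Ω) (R : ℝ) :
    AEStronglyMeasurable (torusDiscrepancy Ω R) torusMeasure := by
  have hcb : Bornology.IsBounded (closure (R • Ω)) := (hb.smul₀ R).closure
  have hf : volume (frontier (R • Ω)) = 0 := (hΩ.smul R).addHaar_frontier _
  have hm := (measurable_torusDiscrepancy_one hcb measurableSet_closure).add_const
    (volume.real (closure (R • Ω)) - R ^ 2 * volume.real Ω)
  refine hm.aestronglyMeasurable.congr ?_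
  filter_upwards [ae_forall_notMem (hcb.subset frontier_subset_closure) hf] with t ht
  have : {k | torusRep t + intPoint k ∈ closure (R • Ω)} = {k | torusRep t + intPoint k ∈ R • Ω} := by
    ext k
    simp only [Set.mem_ofPred_eq]
    refine ⟨fun h => ?_, fun h => subset_closure h⟩
    by_contra hk
    exact ht k ⟨h, fun hi => hk (interior_subset hi)⟩
  rw [torusDiscrepancy, discrepancy_one_eq, torusDiscrepancy, discrepancy_eq, this]
  ring

theorem exists_bound_torusDiscrepancy {Ω : Set Plane} (hb : Bornology.IsBounded Ω) (R : ℝ) :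
    ∃ B, ∀ t, |torusDiscrepancy Ω R t| ≤ B := by
  obtain ⟨B, hB⟩ := exists_bound_torusDiscrepancy_one (hb.smul₀ R)
  refine ⟨B + |volume.real (R • Ω) - R ^ 2 * volume.real Ω|, fun t => ?_⟩
  have : torusDiscrepancy Ω R t
      = torusDiscrepancy (R • Ω) 1 t + (volume.real (R • Ω) - R ^ 2 * volume.real Ω) := by
    rw [torusDiscrepancy, discrepancy_eq, torusDiscrepancy, discrepancy_one_eq]
    ring
  rw [this]
  exact (abs_add_le _ _).trans (by gcongr; exact hB t)

/-! ### Sandwich between averaged discrepancies -/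

theorem torusDiscrepancy_one_add_torusClass (K : Set Plane) (t : Torus) (h : Fin 2 → ℝ) :
    torusDiscrepancy K 1 (t + torusClass h) = discrepancy K 1 (torusRep t + WithLp.toLp 2 h) := by
  rw [← torusDiscrepancy_toTorus]
  congr 1
  conv_lhs => rw [← toTorus_torusRep t]
  funext i
  simp [toTorus, torusClass]

theorem torusAverage_complexDiscrepancy (ν : Measure (Fin 2 → ℝ)) (K : Set Plane) (t : Torus) :
    torusAverage ν (complexDiscrepancy K) t
      = ((∫ h, torusDiscrepancy K 1 (t + torusClass h) ∂ν : ℝ) : ℂ) := by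
  unfold torusAverage complexDiscrepancy
  exact integral_complex_ofReal

theorem integrable_torusDiscrepancy_translate {ν : Measure (Fin 2 → ℝ)} [IsProbabilityMeasure ν]
    {K : Set Plane} (hc : IsCompact K) (t : Torus) :
    Integrable (fun h => torusDiscrepancy K 1 (t + torusClass h)) ν := by
  obtain ⟨B, hB⟩ := exists_bound_torusDiscrepancy_one hc.isBounded
  refine Integrable.of_bound (C := B) (Measurable.aestronglyMeasurable ?_)
    (Filter.Eventually.of_forall fun h => hB _)
  exact (measurable_torusDiscrepancy_one hc.isBounded hc.measurableSet).comp
    (continuous_torusClass.measurable.const_add t)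

/-- Each small shift of K still captures every lattice point of RΩ, so the count is bounded by its
average over shifts; the areas account for the last term. -/
theorem torusDiscrepancy_le_norm_torusAverage {Ω K : Set Plane} {R ε : ℝ} (hε : 0 < ε)
    (hc : IsCompact K)
    (hsub : ∀ x ∈ R • Ω, ∀ q : Plane, (∀ i, |q i| ≤ ε) → x + q ∈ K) (t : Torus) :
    torusDiscrepancy Ω R t ≤ ‖torusAverage (boxUniform ε) (complexDiscrepancy K) t‖
      + (volume.real K - R ^ 2 * volume.real Ω) := by
  have := boxUniform_isProbabilityMeasure hε
  rw [torusAverage_complexDiscrepancy, Complex.norm_real, Real.norm_eq_abs]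
  have h1 : torusDiscrepancy Ω R t - (volume.real K - R ^ 2 * volume.real Ω)
      ≤ ∫ h, torusDiscrepancy K 1 (t + torusClass h) ∂(boxUniform ε) := by
    have h2 := integral_mono_ae (μ := boxUniform ε) (integrable_const
      (torusDiscrepancy Ω R t - (volume.real K - R ^ 2 * volume.real Ω)))
      (integrable_torusDiscrepancy_translate hc t) (by
        filter_upwards [ae_boxUniform_mem hε] with h hh
        rw [torusDiscrepancy_one_add_torusClass, discrepancy_one_eq, torusDiscrepancy,
          discrepancy_eq]
        have : {k | torusRep t + intPoint k ∈ R • Ω}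
            ⊆ {k | torusRep t + WithLp.toLp 2 h + intPoint k ∈ K} := by
          intro k hk
          have := hsub _ hk (WithLp.toLp 2 h) hh
          rwa [add_right_comm] at this
        have : (({k | torusRep t + intPoint k ∈ R • Ω}.ncard : ℕ) : ℝ)
            ≤ ({k | torusRep t + WithLp.toLp 2 h + intPoint k ∈ K}.ncard : ℕ) := by
          exact_mod_cast Set.ncard_le_ncard this (finite_lattice hc.isBounded _)
        linarith)
    simpa using h2
  linarith [le_abs_self (∫ h, torusDiscrepancy K 1 (t + torusClass h) ∂(boxUniform ε))]

theorem neg_norm_torusAverage_le_torusDiscrepancy {Ω K : Set Plane} {R ε : ℝ} (hε : 0 < ε)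
    (hb : Bornology.IsBounded Ω) (hc : IsCompact K)
    (hsub : ∀ x ∈ K, ∀ q : Plane, (∀ i, |q i| ≤ ε) → x + q ∈ R • Ω) (t : Torus) :
    -‖torusAverage (boxUniform ε) (complexDiscrepancy K) t‖
      + (volume.real K - R ^ 2 * volume.real Ω) ≤ torusDiscrepancy Ω R t := by
  have := boxUniform_isProbabilityMeasure hε
  rw [torusAverage_complexDiscrepancy, Complex.norm_real, Real.norm_eq_abs]
  have h1 : ∫ h, torusDiscrepancy K 1 (t + torusClass h) ∂(boxUniform ε)
      ≤ torusDiscrepancy Ω R t - (volume.real K - R ^ 2 * volume.real Ω) := by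
    have h2 := integral_mono_ae (μ := boxUniform ε)
      (integrable_torusDiscrepancy_translate hc t) (integrable_const
      (torusDiscrepancy Ω R t - (volume.real K - R ^ 2 * volume.real Ω))) (by
        filter_upwards [ae_boxUniform_mem hε] with h hh
        rw [torusDiscrepancy_one_add_torusClass, discrepancy_one_eq, torusDiscrepancy,
          discrepancy_eq]
        have : {k | torusRep t + WithLp.toLp 2 h + intPoint k ∈ K}
            ⊆ {k | torusRep t + intPoint k ∈ R • Ω} := by
          intro k hk
          have := hsub _ hk (-WithLp.toLp 2 h) (fun i => by simpa using hh i)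
          rwa [← sub_eq_add_neg, add_right_comm, add_sub_cancel_right] at this
        have : (({k | torusRep t + WithLp.toLp 2 h + intPoint k ∈ K}.ncard : ℕ) : ℝ)
            ≤ ({k | torusRep t + intPoint k ∈ R • Ω}.ncard : ℕ) := by
          exact_mod_cast Set.ncard_le_ncard this (finite_lattice (hb.smul₀ R) _)
        linarith)
    simpa using h2
  linarith [neg_abs_le (∫ h, torusDiscrepancy K 1 (t + torusClass h) ∂(boxUniform ε))]

theorem exists_box_subset_interior {Ω : Set Plane} {p : Plane} (hp : p ∈ interior Ω) :
    ∃ ε > 0, ∀ q : Plane, (∀ i, |q i| ≤ ε) → p + q ∈ interior Ω := by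
  obtain ⟨η, hη, hball⟩ := Metric.isOpen_iff.1 isOpen_interior p hp
  refine ⟨η / 2, by positivity, fun q hq => hball ?_⟩
  rw [mem_ball_iff_norm, add_sub_cancel_left]
  have h1 := EuclideanSpace.norm_sq_eq q
  rw [Fin.sum_univ_two] at h1
  have h2 : ∀ i, ‖q i‖ ^ 2 ≤ (η / 2) ^ 2 := fun i => pow_le_pow_left₀ (norm_nonneg _) (hq i) 2
  have h3 : ‖q‖ ^ 2 < η ^ 2 := by nlinarith [h2 0, h2 1, sq_pos_of_pos hη]
  exact lt_of_pow_lt_pow_left₀ 2 hη.le h3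

theorem volume_real_vadd_smul (v : Plane) (a : ℝ) (s : Set Plane) :
    volume.real (v +ᵥ a • s) = a ^ 2 * volume.real s := by
  rw [measureReal_def, measure_vadd, Measure.addHaar_smul, ENNReal.toReal_mul, measureReal_def,
    ENNReal.toReal_ofReal (abs_nonneg _)]
  simp

/-- With x = Ry, the point x + q + δp = Ry + δ(p + q/δ) is R + δ times a convex combination of
points of Ω. -/
theorem smul_add_mem_outer {Ω : Set Plane} (hΩ : Convex ℝ Ω) {p : Plane} {ε R δ : ℝ}
    (hbox : ∀ q : Plane, (∀ i, |q i| ≤ ε) → p + q ∈ interior Ω) (hR : 0 < R) (hδ : 0 < δ)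
    {x : Plane} (hx : x ∈ R • Ω) {q : Plane} (hq : ∀ i, |q i| ≤ δ * ε) :
    x + q ∈ (-(δ • p)) +ᵥ ((R + δ) • closure Ω) := by
  obtain ⟨y, hy, rfl⟩ := hx
  have h1 : p + δ⁻¹ • q ∈ Ω := interior_subset (hbox _ fun i => by
    rw [PiLp.smul_apply, smul_eq_mul, abs_mul, abs_inv, abs_of_pos hδ, inv_mul_le_iff₀ hδ]
    exact hq i)
  have hs : 0 < R + δ := by positivity
  have h2 := hΩ hy h1 (div_nonneg hR.le hs.le) (div_nonneg hδ.le hs.le) (by field_simp)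
  rw [Set.mem_vadd_set_iff_neg_vadd_mem, neg_neg, vadd_eq_add]
  refine ⟨_, subset_closure h2, ?_⟩
  simp only [smul_add, smul_smul]
  rw [mul_div_cancel₀ _ hs.ne', ← mul_assoc, mul_div_cancel₀ _ hs.ne', mul_inv_cancel₀ hδ.ne',
    one_smul]
  abel

/-- The same combination with weights (R - δ)/R and δ/R. The box must lie in the interior, since
only then does combining with a point of the closure land in Ω itself. -/
theorem smul_add_mem_inner {Ω : Set Plane} (hΩ : Convex ℝ Ω) {p : Plane} {ε R δ : ℝ}
    (hbox : ∀ q : Plane, (∀ i, |q i| ≤ ε) → p + q ∈ interior Ω) (hδ : 0 < δ) (hδR : δ < R)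
    {x : Plane} (hx : x ∈ (δ • p) +ᵥ ((R - δ) • closure Ω)) {q : Plane}
    (hq : ∀ i, |q i| ≤ δ * ε) : x + q ∈ R • Ω := by
  obtain ⟨_, ⟨y, hy, rfl⟩, rfl⟩ := hx
  have h1 : p + δ⁻¹ • q ∈ interior Ω := hbox _ fun i => by
    rw [PiLp.smul_apply, smul_eq_mul, abs_mul, abs_inv, abs_of_pos hδ, inv_mul_le_iff₀ hδ]
    exact hq i
  have hR : 0 < R := hδ.trans hδR
  have h2 := hΩ.combo_closure_interior_subset_interior (a := (R - δ) / R) (b := δ / R)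
    (div_nonneg (by linarith) hR.le) (by positivity) (by field_simp; ring)
    (Set.add_mem_add (Set.smul_mem_smul_set hy) (Set.smul_mem_smul_set h1))
  refine ⟨_, interior_subset h2, ?_⟩
  simp only [smul_add, smul_smul, vadd_eq_add]
  rw [mul_div_cancel₀ _ hR.ne', ← mul_assoc, mul_div_cancel₀ _ hR.ne', mul_inv_cancel₀ hδ.ne',
    one_smul]
  abel

theorem integrable_norm_torusAverage_pow {K : Set Plane} (hc : IsCompact K) {ε : ℝ} (hε : 0 < ε) :
    Integrable (fun t => ‖torusAverage (boxUniform ε) (complexDiscrepancy K) t‖ ^ 4)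
      torusMeasure := by
  have := boxUniform_isProbabilityMeasure hε
  obtain ⟨B, hB⟩ := exists_bound_torusDiscrepancy_one hc.isBounded
  have hB' : ∀ t, ‖complexDiscrepancy K t‖ ≤ B := fun t => by
    rw [complexDiscrepancy, Complex.norm_real]; exact hB t
  have hm : Measurable (complexDiscrepancy K) := Complex.measurable_ofReal.comp
    (measurable_torusDiscrepancy_one hc.isBounded hc.measurableSet)
  refine Integrable.of_bound (C := B ^ 4)
    ((stronglyMeasurable_torusAverage hm).norm.pow 4).aestronglyMeasurable
    (Filter.Eventually.of_forall fun t => ?_)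
  rw [norm_pow, norm_norm]
  exact pow_le_pow_left₀ (norm_nonneg _) (norm_torusAverage_le hB' t) 4

theorem integral_torusAverage_le {K : Set Plane} (hK : Convex ℝ K) (hc : IsCompact K) {ρ : ℝ}
    (hρ : 0 < ρ) (hcap : HasCapRadius K ρ) {ε : ℝ} (hε : 0 < ε) {N : ℕ} (hN : 1 / ε ≤ N) :
    ∫ t, ‖torusAverage (boxUniform ε) (complexDiscrepancy K) t‖ ^ 4 ∂torusMeasure
      ≤ 4096 * ρ ^ 2 * (24 ^ 2 + 8 * (384 ^ 2 * (2 + Real.log N))) := by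
  have h := lintegral_torusAverage_le hK hc hρ hcap hε hN
  have hlog : 0 ≤ Real.log N := Real.log_natCast_nonneg N
  rw [← ENNReal.ofReal_le_ofReal_iff (by positivity), ofReal_integral_eq_lintegral_ofReal
    (integrable_norm_torusAverage_pow hc hε) (Filter.Eventually.of_forall fun t => by positivity)]
  simp_rw [ENNReal.ofReal_pow (norm_nonneg _), ofReal_norm]
  exact h

/-! ### Assembly of the fourth moment bound -/

theorem add_add_pow_four_le (a b c : ℝ) : (a + b + c) ^ 4 ≤ 27 * (a ^ 4 + b ^ 4 + c ^ 4) := by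
  have h1 : (a + b + c) ^ 2 ≤ 3 * (a ^ 2 + b ^ 2 + c ^ 2) := by
    nlinarith [sq_nonneg (a - b), sq_nonneg (b - c), sq_nonneg (a - c)]
  have h2 : (a ^ 2 + b ^ 2 + c ^ 2) ^ 2 ≤ 3 * (a ^ 4 + b ^ 4 + c ^ 4) := by
    nlinarith [sq_nonneg (a ^ 2 - b ^ 2), sq_nonneg (b ^ 2 - c ^ 2), sq_nonneg (a ^ 2 - c ^ 2)]
  have h3 := pow_le_pow_left₀ (sq_nonneg _) h1 2
  nlinarith

/-- Bookkeeping of constants, with I₁ and I₂ the moments for the outer and inner bodies and L = log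
R. The area term is absorbed because R² L ≥ 1. -/
theorem fourth_moment_bound {R δ r V D G L I₁ I₂ : ℝ} (hR : 2 < R) (hδ0 : 0 ≤ δ) (hδ1 : δ ≤ 1)
    (hL : 1 / 2 ≤ L) (hG0 : 0 ≤ G)
    (hG : G ≤ (2 * D + 8 * 384 ^ 2) * L)
    (h₁ : I₁ ≤ 4096 * ((R + δ) * r) ^ 2 * G) (h₂ : I₂ ≤ 4096 * ((R - δ) * r) ^ 2 * G) :
    27 * (I₁ + I₂ + (3 * V) ^ 4)
      ≤ 27 * (40960 * r ^ 2 * (2 * D + 8 * 384 ^ 2) + 162 * V ^ 4) * (R ^ 2 * L) := by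
  have hR2 : 4 ≤ R ^ 2 := by nlinarith
  have hsum : ((R + δ) * r) ^ 2 + ((R - δ) * r) ^ 2 ≤ 10 * (R ^ 2 * r ^ 2) := by
    have h1 : (R + δ) ^ 2 + (R - δ) ^ 2 ≤ 10 * R ^ 2 := by nlinarith
    calc _ = ((R + δ) ^ 2 + (R - δ) ^ 2) * r ^ 2 := by ring
      _ ≤ (10 * R ^ 2) * r ^ 2 := mul_le_mul_of_nonneg_right h1 (sq_nonneg r)
      _ = _ := by ring
  have hI : I₁ + I₂ ≤ 4096 * (10 * (R ^ 2 * r ^ 2)) * ((2 * D + 8 * 384 ^ 2) * L) := by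
    calc I₁ + I₂ ≤ 4096 * (((R + δ) * r) ^ 2 + ((R - δ) * r) ^ 2) * G := by linarith
      _ ≤ _ := by gcongr
  have hVR : (3 * V) ^ 4 ≤ 162 * V ^ 4 * (R ^ 2 * L) := by
    have h1 : 1 ≤ R ^ 2 * L := by nlinarith
    have h2 : 0 ≤ V ^ 4 := by positivity
    nlinarith [mul_le_mul_of_nonneg_left h1 h2]
  linarith

/-- The fourth moment of the discrepancy of a convex set with interior points whose closure has
cap radius `r`. -/
theorem exists_integral_pow_four_le {Ω : Set Plane} (hΩ : Convex ℝ Ω)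
    (hb : Bornology.IsBounded Ω) {r : ℝ} (hr : 0 < r) (hcap : HasCapRadius (closure Ω) r)
    (hne : (interior Ω).Nonempty) :
    ∃ C : ℝ, 0 ≤ C ∧ ∀ R : ℝ, 2 < R →
      ∫ t, |torusDiscrepancy Ω R t| ^ (4 : ℕ) ∂torusMeasure ≤ C * (R ^ 2 * Real.log R) := by
  obtain ⟨p, hp⟩ := hne
  obtain ⟨ε, hε, hbox⟩ := exists_box_subset_interior hp
  set V : ℝ := volume.real Ω with hV
  have hV0 : 0 ≤ V := measureReal_nonneg
  set T : ℝ := Real.log (1 / ε + 1) with hT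
  have hT0 : 0 ≤ T := Real.log_nonneg (by have : 0 < 1 / ε := by positivity
                                          linarith)
  set D : ℝ := 24 ^ 2 + 8 * (384 ^ 2 * (2 + T)) with hD
  refine ⟨27 * (40960 * r ^ 2 * (2 * D + 8 * 384 ^ 2) + 162 * V ^ 4), by positivity,
    fun R hR => ?_⟩
  have hR0 : 0 < R := by linarith
  have hlog : 1 / 2 ≤ Real.log R := by
    have h1 := Real.log_le_log (by norm_num) hR.le
    linarith [Real.log_two_gt_d9]
  -- With this δ the area changes by at most 3V, while the frequency threshold 1/(δε) = R/ε is
  -- linear in R, so its logarithm costs only log R + T.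
  set δ : ℝ := 1 / R with hδ
  have hδ0 : 0 < δ := by positivity
  have hδ1 : δ ≤ 1 := by rw [hδ, div_le_one hR0]; linarith
  have hRδ : R * δ = 1 := by rw [hδ]; field_simp
  have hδε : 0 < δ * ε := by positivity
  set N : ℕ := ⌈1 / (δ * ε)⌉₊ with hN
  have hNle : 1 / (δ * ε) ≤ N := Nat.le_ceil _
  have hNlog : Real.log N ≤ Real.log R + T := by
    have h1 : (N : ℝ) ≤ R * (1 / ε + 1) := by
      have h2 : 1 / (δ * ε) = R * (1 / ε) := by rw [hδ]; field_simp
      have h3 := (Nat.ceil_lt_add_one (a := 1 / (δ * ε)) (by positivity)).le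
      rw [h2] at h3
      rw [hN, h2]
      linarith
    have hN0 : (0 : ℝ) < N := lt_of_lt_of_le (by positivity) hNle
    rw [hT, ← Real.log_mul hR0.ne' (by positivity)]
    exact Real.log_le_log hN0 h1
  have hD0 : 0 ≤ D := by positivity
  have hG0 : 0 ≤ 24 ^ 2 + 8 * (384 ^ 2 * (2 + Real.log N)) := by
    have := Real.log_natCast_nonneg N
    positivity
  have hcc : IsCompact (closure Ω) := hb.isCompact_closure
  have hvc : volume.real (closure Ω) = V :=
    measureReal_congr (closure_ae_eq_of_null_frontier (hΩ.addHaar_frontier volume))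
  set K₁ : Set Plane := (-(δ • p)) +ᵥ ((R + δ) • closure Ω) with hK₁
  set K₂ : Set Plane := (δ • p) +ᵥ ((R - δ) • closure Ω) with hK₂
  have hc₁ : IsCompact K₁ := (hcc.smul (R + δ)).vadd _
  have hc₂ : IsCompact K₂ := (hcc.smul (R - δ)).vadd _
  have hle₁ := torusDiscrepancy_le_norm_torusAverage (Ω := Ω) (R := R) hδε hc₁
    fun x hx q hq => smul_add_mem_outer hΩ hbox hR0 hδ0 hx hq
  have hle₂ := neg_norm_torusAverage_le_torusDiscrepancy (Ω := Ω) (R := R) hδε hb hc₂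
    fun x hx q hq => smul_add_mem_inner hΩ hbox hδ0 (by linarith) hx hq
  have hm₁ := integral_torusAverage_le ((hΩ.closure.smul (R + δ)).vadd (-(δ • p))) hc₁
    (ρ := (R + δ) * r) (by positivity) ((hcap.smul (by positivity)).vadd _) hδε hNle
  have hm₂ := integral_torusAverage_le ((hΩ.closure.smul (R - δ)).vadd (δ • p)) hc₂
    (ρ := (R - δ) * r) (mul_pos (by linarith) hr) ((hcap.smul (by linarith)).vadd _) hδε hNle
  rw [hK₁, volume_real_vadd_smul, hvc, ← hK₁] at hle₁
  rw [hK₂, volume_real_vadd_smul, hvc, ← hK₂] at hle₂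
  set F₁ := torusAverage (boxUniform (δ * ε)) (complexDiscrepancy K₁)
  set F₂ := torusAverage (boxUniform (δ * ε)) (complexDiscrepancy K₂)
  have hi₁ : Integrable (fun t => ‖F₁ t‖ ^ 4) torusMeasure :=
    integrable_norm_torusAverage_pow hc₁ hδε
  have hi₂ : Integrable (fun t => ‖F₂ t‖ ^ 4) torusMeasure :=
    integrable_norm_torusAverage_pow hc₂ hδε
  have habs : ∀ t, |torusDiscrepancy Ω R t| ≤ ‖F₁ t‖ + ‖F₂ t‖ + 3 * V := by
    intro t
    have h1 := hle₁ t
    have h2 := hle₂ t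
    have h3 : (R + δ) ^ 2 * V - R ^ 2 * V ≤ 3 * V := by
      have : (R + δ) ^ 2 - R ^ 2 ≤ 3 := by nlinarith
      nlinarith
    have h4 : -(3 * V) ≤ (R - δ) ^ 2 * V - R ^ 2 * V := by
      have : -3 ≤ (R - δ) ^ 2 - R ^ 2 := by nlinarith
      nlinarith
    rw [abs_le]
    constructor <;> linarith [norm_nonneg (F₁ t), norm_nonneg (F₂ t)]
  have hi₁₂ : Integrable (fun t => ‖F₁ t‖ ^ 4 + ‖F₂ t‖ ^ 4) torusMeasure := hi₁.add hi₂
  have hmain : ∫ t, |torusDiscrepancy Ω R t| ^ (4 : ℕ) ∂torusMeasure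
      ≤ 27 * (∫ t, ‖F₁ t‖ ^ 4 ∂torusMeasure + ∫ t, ‖F₂ t‖ ^ 4 ∂torusMeasure + (3 * V) ^ 4) := by
    calc ∫ t, |torusDiscrepancy Ω R t| ^ (4 : ℕ) ∂torusMeasure
        ≤ ∫ t, 27 * (‖F₁ t‖ ^ 4 + ‖F₂ t‖ ^ 4 + (3 * V) ^ 4) ∂torusMeasure := by
          refine integral_mono_of_nonneg (Filter.Eventually.of_forall fun t => by positivity)
            ((hi₁₂.add (integrable_const _)).const_mul _) (Filter.Eventually.of_forall fun t => ?_)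
          exact (pow_le_pow_left₀ (abs_nonneg _) (habs t) 4).trans (add_add_pow_four_le _ _ _)
      _ = _ := by
          rw [integral_const_mul, integral_add hi₁₂ (integrable_const _), integral_add hi₁ hi₂,
            integral_const, probReal_univ, one_smul]
  -- Since log R ≥ 1/2, the constant D, which contains T, is at most 2D log R.
  refine hmain.trans (fourth_moment_bound hR hδ0.le hδ1 hlog hG0 ?_ hm₁ hm₂)
  have h1 := mul_le_mul_of_nonneg_left hlog hD0
  clear_value D
  rw [add_mul, mul_assoc 2 D]
  linarith

theorem corollary7 (Ω : Set Plane) (hΩ : Convex ℝ Ω)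
    (c : Plane) (r : ℝ) (hr : 0 < r)
    (hroll : RollsUnimpededInside Ω (Metric.closedBall c r)) :
    ∃ C : ℝ, ∀ R : ℝ, 2 < R →
      MemLp (torusDiscrepancy Ω R) 4 torusMeasure ∧
      (∫ t, |torusDiscrepancy Ω R t| ^ (4 : ℕ) ∂torusMeasure) ^ (1 / 4 : ℝ) ≤
        C * R ^ (1 / 2 : ℝ) * (Real.log R) ^ (1 / 4 : ℝ) := by
  have hb := hroll.isBounded hr
  have hmem : ∀ R : ℝ, MemLp (torusDiscrepancy Ω R) 4 torusMeasure := by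
    intro R
    obtain ⟨B, hB⟩ := exists_bound_torusDiscrepancy hb R
    exact MemLp.of_bound (aestronglyMeasurable_torusDiscrepancy hΩ hb R) B
      (Filter.Eventually.of_forall hB)
  have hmoment : ∃ C : ℝ, 0 ≤ C ∧ ∀ R : ℝ, 2 < R →
      ∫ t, |torusDiscrepancy Ω R t| ^ (4 : ℕ) ∂torusMeasure ≤ C * (R ^ 2 * Real.log R) := by
    -- A convex set with empty interior equals its interior up to the null frontier, hence is null,
    -- and the constant 0 works.
    by_cases hne : (interior Ω).Nonempty
    · exact exists_integral_pow_four_le hΩ hb hr (hroll.hasCapRadius hr) hne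
    · have h0 : volume Ω = 0 := by
        rw [← measure_congr (interior_ae_eq_of_null_frontier (hΩ.addHaar_frontier volume)),
          Set.not_nonempty_iff_eq_empty.1 hne, measure_empty]
      refine ⟨0, le_rfl, fun R _ => ?_⟩
      rw [zero_mul, integral_eq_zero_of_ae]
      filter_upwards [torusDiscrepancy_ae_eq_zero hb h0 R] with t ht
      rw [ht]
      simp
  obtain ⟨C, hC, h⟩ := hmoment
  refine ⟨C ^ (1 / 4 : ℝ), fun R hR => ⟨hmem R, ?_⟩⟩
  have hR0 : 0 < R := by linarith
  have hlog : 0 ≤ Real.log R := Real.log_nonneg (by linarith)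
  refine (Real.rpow_le_rpow (integral_nonneg fun t => by positivity) (h R hR)
    (by norm_num)).trans (le_of_eq ?_)
  rw [Real.mul_rpow hC (by positivity), Real.mul_rpow (by positivity) hlog, ← Real.rpow_natCast,
    ← Real.rpow_mul hR0.le, mul_assoc]
  norm_num
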